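/- Let $0<\alpha\le 2$ and $c,a,t>0$. A symmetric $\alpha$-stable process with parameter $c$ is a real Lévy process $X=(X(s))_{s\ge 0}$, started from $0$, with $\mathbb{E}[e^{i\theta X(s)}]=\exp(-s\,c\,|\theta|^{\alpha})$ for all $s\ge 0$, $\theta\in\mathbb{R}$ (for $\alpha=2$ a Brownian motion with variance $2cs$ at time $s$). Let $(X_j)_{j\in\mathbb{Z}}$ be independent copies of such a process and let $\epsilon$ be uniformly distributed on $[0,1]$ and independent of $(X_j)_{j\in\mathbb{Z}}$. Start the $j$-th particle at $u_j=a(j-\epsilon)$, and let $$N_t[0,L]=\sum_{j\in\mathbb{Z}}\mathbf 1\big[X_j(t)+u_j\in[0,L]\big]$$ be the number of particles in $[0,L]$ at time $t$. The number variance is the variance of $N_t[0,L]$ for a given equispaced starting configuration, averaged over the uniform shift: $$V[L]=V_t^{\alpha,c,a}[L]=\mathbb{E}\big[\operatorname{Var}\big(N_t[0,L]\,\big|\,\epsilon\big)\big].$$ Write $g\sim h$ if $g(L)/h(L)\to 1$ as $L\to\infty$, and for $\alpha>1$ put $$\kappa_{sat}=\kappa_{sat}(\alpha,c,a,t)=\frac{2}{a\pi}(2tc)^{1/\alpha}\,\Gamma\Big(1-\frac1\alpha\Big).$$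 **Theorem.** For every $L$, $N_t[0,L]$ is almost surely finite and square-integrable. There is a constant $k\neq 0$, depending only on $\alpha,c,a,t$, such that as $L\to\infty$: 1. if $\alpha\in(0,1)$, then $V[L]\sim k\,L^{1-\alpha}$; 2. if $\alpha=1$, then $V[L]\sim k\log L$; 3. if $\alpha\in(1,2)$, then $V[L]\sim k\,L^{1-\alpha}+\kappa_{sat}$, and moreover $V[L]-\kappa_{sat}\sim k\,L^{1-\alpha}$; 4. if $\alpha=2$, then $V[L]\sim k\,e^{-L^2/(8ct)}+\kappa_{sat}$, and moreover $V[L]-\kappa_{sat}=O\big(e^{-L^2/(8ct)}\big)$. Furthermore, if $\alpha\in(1,2]$, then each $X_j(2t/a^{\alpha})$ is integrable and $\kappa_{sat}=\mathbb{E}\,\big|X_j(2t/a^{\alpha})\big|$. -/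

import Mathlib

open MeasureTheory ProbabilityTheory Filter Topology Asymptotics
open scoped NNReal

namespace StableParticles

/-- A real-valued Lévy process started from `0`. -/
structure IsLevyProcess {Ω : Type*} [MeasurableSpace Ω] (X : ℝ≥0 → Ω → ℝ) (P : Measure Ω) :
    Prop where
  measurable : ∀ t, Measurable (X t)
  start_zero : ∀ᵐ ω ∂P, X 0 ω = 0
  indep_increments : HasIndepIncrements X P
  stationary_increments : ∀ s t,
    Measure.map (fun ω => X (s + t) ω - X s ω) P = Measure.map (X t) P
  stochastically_continuous : ∀ t, TendstoInMeasure P X (𝓝 t) (X t)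
  cadlag : ∀ᵐ ω ∂P, ∀ t,
    ContinuousWithinAt (fun s => X s ω) (Set.Ici t) t ∧
      ∃ l, Tendsto (fun s => X s ω) (𝓝[<] t) (𝓝 l)

/-- A symmetric `α`-stable process with characteristic function
`𝔼[exp (i θ X(t))] = exp (-t c |θ|^α)`; for `α = 2` this is a Brownian motion of variance
`2 c t` at time `t`. -/
structure IsSymmetricStable {Ω : Type*} [MeasurableSpace Ω] (α c : ℝ)
    (X : ℝ≥0 → Ω → ℝ) (P : Measure Ω) : Prop extends IsLevyProcess X P where
  charFun_eq : ∀ (t : ℝ≥0) (θ : ℝ),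
    charFun (Measure.map (X t) P) θ = ((Real.exp (-(t * c * |θ| ^ α)) : ℝ) : ℂ)

/-- The data of the particle system: a uniform variable `ε` on `[0,1]` and independent copies
`X j`, `j ∈ ℤ`, of a symmetric `α`-stable process, jointly independent of `ε`. -/
structure IsStableSystem {Ω : Type*} [MeasurableSpace Ω] (α c : ℝ)
    (ε : Ω → ℝ) (X : ℤ → ℝ≥0 → Ω → ℝ) (P : Measure Ω) : Prop where
  measurable_shift : Measurable ε
  uniform_shift : pdf.IsUniform ε (Set.Icc 0 1) P volume
  stable : ∀ j, IsSymmetricStable α c (X j) P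
  indep : iIndepFun (fun j ω t => X j t ω) P
  indep_shift : IndepFun ε (fun ω j t => X j t ω) P

/-- The position at time `t` of the particle with index `j`, started from `a (j - ε)`. -/
def position {Ω : Type*} (a : ℝ) (ε : Ω → ℝ) (X : ℤ → ℝ≥0 → Ω → ℝ) (t : ℝ≥0) (j : ℤ)
    (ω : Ω) : ℝ :=
  X j t ω + a * (j - ε ω)

/-- The number of particles in `[0, L]` at time `t`, as a sum of indicators. -/
noncomputable def count {Ω : Type*} (a : ℝ) (ε : Ω → ℝ) (X : ℤ → ℝ≥0 → Ω → ℝ) (t : ℝ≥0)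
    (L : ℝ) (ω : Ω) : ℝ :=
  ∑' j : ℤ, Set.indicator (Set.Icc 0 L) (fun _ => (1 : ℝ)) (position a ε X t j ω)

/-- The (averaged) number variance `𝔼_ε [Var (N_t[0, L] | ε)]`: the variance of the number of
particles in `[0, L]` for a fixed equispaced starting configuration `a (j - ε)`, averaged
over the uniform shift `ε`. -/
noncomputable def numberVariance {Ω : Type*} [MeasurableSpace Ω] (a : ℝ) (ε : Ω → ℝ)
    (X : ℤ → ℝ≥0 → Ω → ℝ) (t : ℝ≥0) (P : Measure Ω) (L : ℝ) : ℝ :=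
  ∫ ω, condVar (MeasurableSpace.comap ε inferInstance) (count a ε X t L) P ω ∂P

/-- `g ∼ h` as `L → ∞`, i.e. `lim g / h = 1`. -/
def Sim (g h : ℝ → ℝ) : Prop :=
  Tendsto (fun L => g L / h L) atTop (𝓝 1)

/-- The saturation level `κ_sat(α, c, a, t)`. -/
noncomputable def kappaSat (α c a t : ℝ) : ℝ :=
  2 / (a * Real.pi) * (2 * t * c) ^ (1 / α) * Real.Gamma (1 - 1 / α)

end StableParticles

namespace StableParticles

/-! ### Fourier integrals built from `1 - cos`. -/

section Analysis

open Set Real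

/-! Given the shift, the events that the individual particles lie in `[0, L]` are independent, so
the conditional variance is `∑ p_j (1 - p_j)`, where `p_j` is the hitting probability from `a (j -
ε)`. Averaging over the uniform shift unfolds the lattice sum into an integral over all starting
points. There `p (1 - p)` is the probability that one of two independent displacements hits the
window while the other misses it. Integrating the starting point out first leaves the length of an
interval minus its translate, hence `V[L] = 𝔼 min(|Y|, L) / a`, where `Y` is the difference of two
independent copies of `X(t)` and has characteristic function `exp (-s |θ|^α)`, `s = 2tc`
(`IsPairwiseSystem.hasSum_integral_condVar`, `lintegral_sectionProb_mul_compl`,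
`IsPairwiseSystem.integral_condVar_hitSet`).

The truncated moment is read off the characteristic function: `𝔼 min(|Y|, L)` is `2/π` times the
integral over `θ > 0` of `(1 - cos θL) (1 - exp (-s θ^α)) / θ²` (`integral_min_abs_of_charFun`). As
`L → ∞` the behaviour of the last factor at `θ = 0`, namely `s θ^(α-2)`, decides. For `α < 1`,
rescaling `u = θL` and dominated convergence suffice. For `α = 1`, the singularity `s/θ` is compared
with `s exp (-θ)/θ`, whose integral is an explicit logarithm. For `α > 1`, the factor is integrable
and yields `𝔼|Y| = a κ_sat`; the remaining cosine integral is integrated by parts once and then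
rescaled when `α < 2`. For `α = 2` the law is Gaussian and the excess `𝔼(|Y| - L)⁺` is bounded
directly. -/

lemma one_sub_cos_nonneg (x : ℝ) : 0 ≤ 1 - cos x := by linarith [cos_le_one x]

lemma one_sub_cos_le_two (x : ℝ) : 1 - cos x ≤ 2 := by linarith [neg_one_le_cos x]

lemma one_sub_cos_le_sq (x : ℝ) : 1 - cos x ≤ x ^ 2 := by
  nlinarith [one_sub_sq_div_two_le_cos (x := x), sq_nonneg x]

lemma tendsto_exp_neg_mul_atTop {x : ℝ} (hx : 0 < x) :
    Tendsto (fun u : ℝ => exp (-(x * u))) atTop (𝓝 0) :=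
  tendsto_exp_neg_atTop_nhds_zero.comp (tendsto_id.const_mul_atTop hx)

lemma integrableOn_one_sub_cos_mul_exp {x : ℝ} (hx : 0 < x) :
    IntegrableOn (fun u => (1 - cos u) * (x * exp (-(x * u)))) (Ioi 0) ∧
      ∫ u in Ioi 0, (1 - cos u) * (x * exp (-(x * u))) = (1 + x ^ 2)⁻¹ := by
  have hx2 : (1 + x ^ 2) ≠ 0 := by positivity
  -- An antiderivative vanishing at infinity, with `F 0 = -(1 + x²)⁻¹`. The nonnegative integrand
  -- then gives integrability and the value at once.
  let F : ℝ → ℝ := fun u => -exp (-(x * u)) + x * (exp (-(x * u)) * (x * cos u - sin u)) / (1 + x ^ 2)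
  have hd : ∀ u ∈ Ici (0 : ℝ), HasDerivAt F ((1 - cos u) * (x * exp (-(x * u)))) u := by
    intro u _
    have he : HasDerivAt (fun u => exp (-(x * u))) (exp (-(x * u)) * (-x)) u := by
      have := ((hasDerivAt_id u).const_mul x).neg.exp
      simpa using this
    have ht : HasDerivAt (fun u => x * cos u - sin u) (x * -sin u - cos u) u :=
      ((hasDerivAt_cos u).const_mul x).sub (hasDerivAt_sin u)
    refine (he.neg.add (((he.mul ht).const_mul x).div_const (1 + x ^ 2))).congr_deriv ?_
    field_simp
    ring
  have hpos : ∀ u ∈ Ioi (0 : ℝ), 0 ≤ (1 - cos u) * (x * exp (-(x * u))) := fun u _ =>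
    mul_nonneg (one_sub_cos_nonneg u) (by positivity)
  have hlim : Tendsto F atTop (𝓝 0) := by
    have he := tendsto_exp_neg_mul_atTop hx
    have hb : Tendsto (fun u => exp (-(x * u)) * (x * cos u - sin u)) atTop (𝓝 0) := by
      refine he.zero_mul_isBoundedUnder_le ?_
      refine isBoundedUnder_of ⟨x + 1, fun u => ?_⟩
      simp only [Function.comp, norm_eq_abs]
      calc |x * cos u - sin u| ≤ |x * cos u| + |sin u| := abs_sub _ _
        _ ≤ x + 1 := by
          rw [abs_mul, abs_of_pos hx]
          nlinarith [abs_cos_le_one u, abs_sin_le_one u]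
    simpa [F] using he.neg.add ((hb.const_mul x).div_const (1 + x ^ 2))
  refine ⟨integrableOn_Ioi_deriv_of_nonneg' hd hpos hlim, ?_⟩
  rw [integral_Ioi_of_hasDerivAt_of_nonneg' hd hpos hlim]
  simp only [F, mul_zero, neg_zero, exp_zero, cos_zero, sin_zero]
  field_simp
  ring

lemma lintegral_mul_exp_neg_mul {u : ℝ} (hu : 0 < u) :
    ∫⁻ x in Ioi (0 : ℝ), ENNReal.ofReal (x * exp (-(x * u))) = ENNReal.ofReal (1 / u ^ 2) := by
  have hd : ∀ x ∈ Ici (0 : ℝ),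
      HasDerivAt (fun x => -((x / u + 1 / u ^ 2) * exp (-(x * u)))) (x * exp (-(x * u))) x := by
    intro x _
    have he : HasDerivAt (fun x => exp (-(x * u))) (exp (-(x * u)) * (-u)) x := by
      have := ((hasDerivAt_id x).mul_const u).neg.exp
      simpa using this
    refine ((((hasDerivAt_id x).div_const u).add_const (1 / u ^ 2)).mul he).neg.congr_deriv ?_
    simp only [id]
    field_simp
    ring
  have hpos : ∀ x ∈ Ioi (0 : ℝ), 0 ≤ x * exp (-(x * u)) := fun x hx =>
    mul_nonneg (le_of_lt hx) (exp_pos _).le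
  have hlim : Tendsto (fun x => -((x / u + 1 / u ^ 2) * exp (-(x * u)))) atTop (𝓝 0) := by
    have h1 : Tendsto (fun x : ℝ => x * u * exp (-(x * u))) atTop (𝓝 0) := by
      have := (tendsto_pow_mul_exp_neg_atTop_nhds_zero 1).comp
        (tendsto_id.atTop_mul_const hu)
      simpa [Function.comp_def] using this
    have h2 : Tendsto (fun x : ℝ => exp (-(x * u))) atTop (𝓝 0) := by
      simpa [mul_comm] using tendsto_exp_neg_mul_atTop hu
    have := ((h1.add h2).const_mul (1 / u ^ 2)).neg
    simp only [add_zero, mul_zero, neg_zero] at this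
    refine this.congr fun x => ?_
    field_simp
  have hint := integrableOn_Ioi_deriv_of_nonneg' hd hpos hlim
  rw [← ofReal_integral_eq_lintegral_ofReal hint
    ((ae_restrict_iff' measurableSet_Ioi).2 (ae_of_all _ hpos)),
    integral_Ioi_of_hasDerivAt_of_nonneg' hd hpos hlim]
  simp

/-- Write `1/u²` as the integral of `x exp (-xu)` over `x > 0` and apply Tonelli: the inner integral
becomes `1/(1 + x²)`. Working with `∫⁻` makes finiteness part of the conclusion. -/
lemma lintegral_one_sub_cos_div_sq :
    ∫⁻ u in Ioi (0 : ℝ), ENNReal.ofReal ((1 - cos u) / u ^ 2) = ENNReal.ofReal (π / 2) := by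
  have h1 : ∀ u ∈ Ioi (0 : ℝ), ENNReal.ofReal ((1 - cos u) / u ^ 2) =
      ∫⁻ x in Ioi (0 : ℝ), ENNReal.ofReal ((1 - cos u) * (x * exp (-(x * u)))) := by
    intro u hu
    simp_rw [ENNReal.ofReal_mul (one_sub_cos_nonneg u)]
    rw [lintegral_const_mul _ (by fun_prop), lintegral_mul_exp_neg_mul hu,
      ← ENNReal.ofReal_mul (one_sub_cos_nonneg u)]
    congr 1
    ring
  have h2 : ∀ x ∈ Ioi (0 : ℝ),
      ∫⁻ u in Ioi (0 : ℝ), ENNReal.ofReal ((1 - cos u) * (x * exp (-(x * u)))) =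
        ENNReal.ofReal ((1 + x ^ 2)⁻¹) := by
    intro x hx
    obtain ⟨hi, he⟩ := integrableOn_one_sub_cos_mul_exp hx
    rw [← he, ofReal_integral_eq_lintegral_ofReal hi]
    filter_upwards with u
    exact mul_nonneg (one_sub_cos_nonneg u) (mul_nonneg (le_of_lt hx) (exp_pos _).le)
  rw [setLIntegral_congr_fun measurableSet_Ioi h1, lintegral_lintegral_swap (by fun_prop),
    setLIntegral_congr_fun measurableSet_Ioi h2,
    ← ofReal_integral_eq_lintegral_ofReal integrable_inv_one_add_sq.integrableOn
      (ae_of_all _ fun x => by positivity), integral_Ioi_inv_one_add_sq]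
  simp

lemma integrableOn_one_sub_cos_div_sq :
    IntegrableOn (fun u => (1 - cos u) / u ^ 2) (Ioi 0) := by
  refine ⟨Measurable.aestronglyMeasurable (by fun_prop), ?_⟩
  rw [hasFiniteIntegral_iff_ofReal (ae_of_all _ fun u => div_nonneg (one_sub_cos_nonneg u)
    (sq_nonneg u)), lintegral_one_sub_cos_div_sq]
  exact ENNReal.ofReal_lt_top

lemma integral_one_sub_cos_div_sq : ∫ u in Ioi (0 : ℝ), (1 - cos u) / u ^ 2 = π / 2 := by
  rw [integral_eq_lintegral_of_nonneg_ae (ae_of_all _ fun u => div_nonneg (one_sub_cos_nonneg u)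
    (sq_nonneg u)) (Measurable.aestronglyMeasurable (by fun_prop)), lintegral_one_sub_cos_div_sq,
    ENNReal.toReal_ofReal (by positivity)]

lemma integrableOn_one_sub_cos_mul_div_sq (y : ℝ) :
    IntegrableOn (fun θ => (1 - cos (θ * y)) / θ ^ 2) (Ioi 0) ∧
      ∫ θ in Ioi (0 : ℝ), (1 - cos (θ * y)) / θ ^ 2 = π / 2 * |y| := by
  rcases eq_or_ne y 0 with rfl | hy
  · simp
  have hy' : 0 < |y| := abs_pos.2 hy
  have h : (fun θ : ℝ => (1 - cos (θ * y)) / θ ^ 2) =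
      fun θ => |y| ^ 2 * ((1 - cos (|y| * θ)) / (|y| * θ) ^ 2) := by
    ext θ
    have : cos (|y| * θ) = cos (θ * y) := by
      rcases abs_choice y with h | h <;> rw [h]
      · rw [mul_comm]
      · rw [neg_mul, cos_neg, mul_comm]
    rw [this, mul_pow]
    rcases eq_or_ne θ 0 with rfl | hθ
    · simp
    · field_simp
  rw [h]
  constructor
  · refine Integrable.const_mul ?_ _
    have := (integrableOn_Ioi_comp_mul_left_iff (fun u => (1 - cos u) / u ^ 2) 0 hy').2
    rw [mul_zero] at this
    exact this integrableOn_one_sub_cos_div_sq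
  · rw [integral_const_mul, integral_comp_mul_left_Ioi (fun u => (1 - cos u) / u ^ 2) 0 hy',
      mul_zero, integral_one_sub_cos_div_sq, smul_eq_mul]
    field_simp

/-- The product formula for cosines reduces this to four integrals of the previous type, and `|L| +
|y| - (|L + y| + |L - y|)/2` is the minimum. -/
lemma integral_one_sub_cos_mul_one_sub_cos_div_sq {L : ℝ} (hL : 0 ≤ L) (y : ℝ) :
    ∫ θ in Ioi (0 : ℝ), (1 - cos (θ * L)) * (1 - cos (θ * y)) / θ ^ 2 = π / 2 * min |y| L := by
  have h : ∀ θ : ℝ, (1 - cos (θ * L)) * (1 - cos (θ * y)) / θ ^ 2 =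
      ((1 - cos (θ * L)) / θ ^ 2 + (1 - cos (θ * y)) / θ ^ 2) -
        (1 / 2) * ((1 - cos (θ * (L + y))) / θ ^ 2 + (1 - cos (θ * (L - y))) / θ ^ 2) := by
    intro θ
    rw [mul_add θ, mul_sub θ, cos_add, cos_sub]
    ring
  simp_rw [h]
  obtain ⟨i1, e1⟩ := integrableOn_one_sub_cos_mul_div_sq L
  obtain ⟨i2, e2⟩ := integrableOn_one_sub_cos_mul_div_sq y
  obtain ⟨i3, e3⟩ := integrableOn_one_sub_cos_mul_div_sq (L + y)
  obtain ⟨i4, e4⟩ := integrableOn_one_sub_cos_mul_div_sq (L - y)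
  rw [integral_sub (by exact i1.add i2) (by exact (i3.add i4).const_mul _), integral_const_mul,
    integral_add i1 i2, integral_add i3 i4, e1, e2, e3, e4]
  have : |L| + |y| - (1 / 2) * (|L + y| + |L - y|) = min |y| L := by
    rw [abs_of_nonneg hL]
    rcases le_total |y| L with hh | hh
    · rw [min_eq_left hh]
      obtain ⟨h1, h2⟩ := abs_le.1 hh
      rw [abs_of_nonneg (by linarith : 0 ≤ L + y), abs_of_nonneg (by linarith : 0 ≤ L - y)]
      ring
    · rw [min_eq_right hh]
      rcases le_total 0 y with h0 | h0
      · rw [abs_of_nonneg h0] at hh ⊢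
        rw [abs_of_nonneg (by linarith : 0 ≤ L + y), abs_of_nonpos (by linarith : L - y ≤ 0)]
        ring
      · rw [abs_of_nonpos h0] at hh ⊢
        rw [abs_of_nonpos (by linarith : L + y ≤ 0), abs_of_nonneg (by linarith : 0 ≤ L - y)]
        ring
  rw [← this]
  ring

/-! ### Truncated and absolute first moments from a real characteristic function. -/

section CharFun

variable {ρ : Measure ℝ} [IsProbabilityMeasure ρ] {φ : ℝ → ℝ}

lemma integral_cos_of_charFun (hφ : ∀ θ, charFun ρ θ = (φ θ : ℂ)) (θ : ℝ) :
    ∫ y, cos (θ * y) ∂ρ = φ θ := by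
  have h := congrArg Complex.re (hφ θ)
  rw [charFun_apply_real, Complex.ofReal_re] at h
  have hi : Integrable (fun y : ℝ => Complex.exp (θ * y * Complex.I)) ρ := by
    refine (integrable_const (1 : ℝ)).mono' (by fun_prop) (ae_of_all _ fun y => ?_)
    rw [← Complex.ofReal_mul, Complex.norm_exp_ofReal_mul_I]
  rw [← h]
  change _ = RCLike.re (∫ y, Complex.exp (θ * y * Complex.I) ∂ρ)
  rw [← integral_re hi]
  congr 1 with y
  rw [← Complex.ofReal_mul]
  exact (Complex.exp_ofReal_mul_I_re _).symm

lemma integrable_cos_mul (θ : ℝ) : Integrable (fun y => cos (θ * y)) ρ :=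
  (integrable_const (1 : ℝ)).mono' (by fun_prop) (ae_of_all _ fun y => abs_cos_le_one _)

lemma integral_one_sub_cos_of_charFun (hφ : ∀ θ, charFun ρ θ = (φ θ : ℂ)) (θ : ℝ) :
    ∫ y, (1 - cos (θ * y)) ∂ρ = 1 - φ θ := by
  rw [integral_sub (integrable_const _) (integrable_cos_mul θ), integral_cos_of_charFun hφ]
  simp

lemma integral_min_abs_of_charFun (hφ : ∀ θ, charFun ρ θ = (φ θ : ℂ)) {L : ℝ} (hL : 0 ≤ L) :
    ∫ y, min |y| L ∂ρ =
      2 / π * ∫ θ in Ioi (0 : ℝ), (1 - cos (θ * L)) * (1 - φ θ) / θ ^ 2 := by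
  have h1 : ∀ y, min |y| L =
      2 / π * ∫ θ in Ioi (0 : ℝ), (1 - cos (θ * L)) * (1 - cos (θ * y)) / θ ^ 2 := by
    intro y
    rw [integral_one_sub_cos_mul_one_sub_cos_div_sq hL]
    field_simp
  simp_rw [h1]
  rw [integral_const_mul, integral_integral_swap]
  · congr 1
    congr 1 with θ
    rw [← integral_one_sub_cos_of_charFun hφ, mul_div_right_comm, ← integral_const_mul]
    congr 1 with y
    ring
  -- Fubini needs no moment of `ρ`: the factor `1 - cos (θ y)` is at most `2`, and the rest is
  -- integrable in `θ` alone.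
  · have hd : Integrable (fun z : ℝ × ℝ => (1 : ℝ) * (2 * ((1 - cos (z.2 * L)) / z.2 ^ 2)))
        (ρ.prod (volume.restrict (Ioi 0))) :=
      (integrable_const (1 : ℝ)).mul_prod
        ((integrableOn_one_sub_cos_mul_div_sq L).1.const_mul 2)
    refine hd.mono' (Measurable.aestronglyMeasurable (by unfold Function.uncurry; fun_prop)) (ae_of_all _ fun z => ?_)
    rw [Function.uncurry_def, norm_eq_abs, abs_of_nonneg (div_nonneg (mul_nonneg
      (one_sub_cos_nonneg _) (one_sub_cos_nonneg _)) (sq_nonneg _)), one_mul,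
      mul_div_assoc', mul_comm 2]
    gcongr
    · exact one_sub_cos_nonneg _
    · exact one_sub_cos_le_two _

/-- Here nothing is truncated, so Tonelli replaces Fubini and integrability of `|y|` comes out of
the computation. -/
lemma integrable_abs_of_charFun (hφ : ∀ θ, charFun ρ θ = (φ θ : ℂ))
    (hi : IntegrableOn (fun θ => (1 - φ θ) / θ ^ 2) (Ioi 0)) :
    Integrable (fun y => |y|) ρ ∧
      ∫ y, |y| ∂ρ = 2 / π * ∫ θ in Ioi (0 : ℝ), (1 - φ θ) / θ ^ 2 := by
  have hφ1 : ∀ θ, 0 ≤ (1 - φ θ) / θ ^ 2 := fun θ => by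
    rw [← integral_one_sub_cos_of_charFun hφ]
    exact div_nonneg (integral_nonneg fun y => one_sub_cos_nonneg _) (sq_nonneg _)
  have h1 : ∀ y : ℝ, ENNReal.ofReal |y| = ENNReal.ofReal (2 / π) *
      ∫⁻ θ in Ioi (0 : ℝ), ENNReal.ofReal ((1 - cos (θ * y)) / θ ^ 2) := by
    intro y
    rw [← ofReal_integral_eq_lintegral_ofReal (integrableOn_one_sub_cos_mul_div_sq y).1
      (ae_of_all _ fun θ => div_nonneg (one_sub_cos_nonneg _) (sq_nonneg _)),
      (integrableOn_one_sub_cos_mul_div_sq y).2, ← ENNReal.ofReal_mul (by positivity)]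
    congr 1
    field_simp
  have key : ∫⁻ y, ENNReal.ofReal |y| ∂ρ =
      ENNReal.ofReal (2 / π * ∫ θ in Ioi (0 : ℝ), (1 - φ θ) / θ ^ 2) := by
    simp_rw [h1]
    rw [lintegral_const_mul' _ _ ENNReal.ofReal_ne_top, lintegral_lintegral_swap (by fun_prop),
      ENNReal.ofReal_mul (by positivity),
      ofReal_integral_eq_lintegral_ofReal hi (ae_of_all _ hφ1)]
    congr 1
    congr 1 with θ
    rw [← integral_one_sub_cos_of_charFun hφ, ← integral_div,
      ofReal_integral_eq_lintegral_ofReal]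
    · exact ((integrable_const _).sub (integrable_cos_mul θ)).div_const _
    · exact ae_of_all _ fun y => div_nonneg (one_sub_cos_nonneg _) (sq_nonneg _)
  have hint : Integrable (fun y : ℝ => |y|) ρ := by
    refine ⟨Measurable.aestronglyMeasurable (by fun_prop), ?_⟩
    rw [hasFiniteIntegral_iff_ofReal (ae_of_all _ fun y => abs_nonneg y), key]
    exact ENNReal.ofReal_lt_top
  refine ⟨hint, ?_⟩
  rw [integral_eq_lintegral_of_nonneg_ae (ae_of_all _ fun y => abs_nonneg y) (by fun_prop), key,
    ENNReal.toReal_ofReal]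
  exact mul_nonneg (by positivity) (integral_nonneg hφ1)

end CharFun

/-! ### Integrals over the positive half-line -/

lemma integrableOn_Ioi_of_rpow_bound {f : ℝ → ℝ} (hf : Measurable f) {C p q : ℝ} (hp : -1 < p)
    (hq : q < -1) (h0 : ∀ x, 0 < x → x ≤ 1 → |f x| ≤ C * x ^ p)
    (h1 : ∀ x, 1 < x → |f x| ≤ C * x ^ q) : IntegrableOn f (Ioi 0) := by
  rw [← Ioc_union_Ioi_eq_Ioi zero_le_one]
  refine IntegrableOn.union ?_ ?_
  · have hi : IntegrableOn (fun x : ℝ => C * x ^ p) (Ioc 0 1) :=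
      ((intervalIntegrable_iff_integrableOn_Ioc_of_le zero_le_one).1
        (intervalIntegral.intervalIntegrable_rpow' hp)).const_mul C
    exact hi.mono' hf.aestronglyMeasurable
      ((ae_restrict_iff' measurableSet_Ioc).2 (ae_of_all _ fun x hx => h0 x hx.1 hx.2))
  · have hi : IntegrableOn (fun x : ℝ => C * x ^ q) (Ioi 1) :=
      (integrableOn_Ioi_rpow_of_lt hq zero_lt_one).const_mul C
    exact hi.mono' hf.aestronglyMeasurable
      ((ae_restrict_iff' measurableSet_Ioi).2 (ae_of_all _ fun x hx => h1 x hx))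

/-- Only one-sided limits at `0` are required, since the antiderivatives below contain negative
powers. It is integration by parts against the constant `1`. -/
lemma integral_Ioi_deriv_eq_zero {F f : ℝ → ℝ} (hd : ∀ x, 0 < x → HasDerivAt F (f x) x)
    (hf : IntegrableOn f (Ioi 0)) (h0 : Tendsto F (𝓝[>] 0) (𝓝 0))
    (h1 : Tendsto F atTop (𝓝 0)) : ∫ x in Ioi (0 : ℝ), f x = 0 := by
  have := integral_Ioi_mul_deriv_eq_deriv_mul (u := fun _ : ℝ => (1 : ℝ)) (u' := fun _ => 0)
    (v := F) (v' := f) (a := 0) (a' := 0) (b' := 0) (fun x _ => hasDerivAt_const x 1)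
    (fun x hx => hd x hx) (by simpa [Pi.mul_def] using hf) (by simp [Pi.mul_def])
    (by simpa [Pi.mul_def] using h0) (by simpa [Pi.mul_def] using h1)
  simpa using this

lemma tendsto_zero_of_abs_le_rpow_nhdsGT {F : ℝ → ℝ} {C p : ℝ} (hp : 0 < p)
    (h : ∀ x, 0 < x → |F x| ≤ C * x ^ p) : Tendsto F (𝓝[>] 0) (𝓝 0) := by
  have hlim : Tendsto (fun x : ℝ => C * x ^ p) (𝓝[>] 0) (𝓝 0) := by
    have := ((continuousAt_rpow_const 0 p (Or.inr hp.le)).tendsto.const_mul C).mono_left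
      (nhdsWithin_le_nhds (s := Ioi 0))
    simpa [zero_rpow hp.ne'] using this
  refine squeeze_zero_norm' ?_ hlim
  filter_upwards [self_mem_nhdsWithin] with x hx using h x hx

lemma tendsto_zero_of_abs_le_rpow_atTop {F : ℝ → ℝ} {C p : ℝ} (hp : p < 0)
    (h : ∀ x, 0 < x → |F x| ≤ C * x ^ p) : Tendsto F atTop (𝓝 0) := by
  have hlim : Tendsto (fun x : ℝ => C * x ^ p) atTop (𝓝 0) := by
    simpa using (tendsto_rpow_neg_atTop (neg_pos.2 hp)).const_mul C
  refine squeeze_zero_norm' ?_ hlim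
  filter_upwards [eventually_gt_atTop 0] with x hx using h x hx

/-- Rescaled integrals against a function behaving like `A θ ^ β` near `0`. -/
lemma tendsto_rpow_mul_integral_comp_mul {w K : ℝ → ℝ} {A C β : ℝ} (hw : Measurable w)
    (hK : Measurable K) (hint : IntegrableOn (fun u => w u * u ^ β) (Ioi 0))
    (hbound : ∀ θ, 0 < θ → |K θ| ≤ C * θ ^ β)
    (hlim : Tendsto (fun θ => K θ / θ ^ β) (𝓝[>] 0) (𝓝 A)) :
    Tendsto (fun L => L ^ (1 + β) * ∫ θ in Ioi (0 : ℝ), w (θ * L) * K θ) atTop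
      (𝓝 (A * ∫ u in Ioi (0 : ℝ), w u * u ^ β)) := by
  -- The substitution `u = θL` moves `L` into the argument of `K`; dividing by `(u / L) ^ β`
  -- isolates a ratio bounded by `C` and tending to `A`.
  have heq : ∀ L : ℝ, 0 < L → ∫ u in Ioi (0 : ℝ), w u * u ^ β * (K (u / L) / (u / L) ^ β) =
      L ^ (1 + β) * ∫ θ in Ioi (0 : ℝ), w (θ * L) * K θ := by
    intro L hL
    have h := integral_comp_mul_left_Ioi (fun u => w u * K (u / L)) 0 hL
    have h' : ∀ θ, K (L * θ / L) = K θ := fun θ => by rw [mul_div_cancel_left₀ _ hL.ne']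
    simp only [mul_zero, smul_eq_mul, h'] at h
    simp_rw [mul_comm _ L]
    rw [h, rpow_add hL, rpow_one, mul_comm L, mul_assoc, mul_inv_cancel_left₀ hL.ne',
      ← integral_const_mul]
    refine setIntegral_congr_fun measurableSet_Ioi fun u hu => ?_
    have hu : 0 < u := hu
    have h1 : u ^ β ≠ 0 := (rpow_pos_of_pos hu _).ne'
    have h2 : L ^ β ≠ 0 := (rpow_pos_of_pos hL _).ne'
    simp only [div_rpow hu.le hL.le]
    field_simp
  have key : Tendsto
      (fun L => ∫ u in Ioi (0 : ℝ), w u * u ^ β * (K (u / L) / (u / L) ^ β)) atTop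
      (𝓝 (∫ u in Ioi (0 : ℝ), w u * u ^ β * A)) := by
    refine tendsto_integral_filter_of_dominated_convergence (fun u => C * |w u * u ^ β|) ?_ ?_
      (hint.abs.const_mul C) ?_
    · exact Eventually.of_forall fun L => Measurable.aestronglyMeasurable (by fun_prop)
    · filter_upwards [eventually_gt_atTop 0] with L hL
      refine (ae_restrict_iff' measurableSet_Ioi).2 (ae_of_all _ fun u hu => ?_)
      have hp : 0 < (u / L) ^ β := rpow_pos_of_pos (div_pos hu hL) _
      rw [norm_eq_abs, abs_mul, mul_comm, abs_div, abs_of_pos hp]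
      gcongr
      rw [div_le_iff₀ hp]
      exact hbound _ (div_pos hu hL)
    · refine (ae_restrict_iff' measurableSet_Ioi).2 (ae_of_all _ fun u hu => ?_)
      refine Tendsto.const_mul _ (hlim.comp ?_)
      refine tendsto_nhdsWithin_iff.2 ⟨tendsto_const_nhds.div_atTop tendsto_id, ?_⟩
      filter_upwards [eventually_gt_atTop 0] with L hL using div_pos hu hL
  rw [integral_mul_const, mul_comm] at key
  refine key.congr' ?_
  filter_upwards [eventually_gt_atTop 0] with L hL using heq L hL

lemma integrableOn_one_sub_cos_mul_rpow {β : ℝ} (h1 : -3 < β) (h2 : β < -1) :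
    IntegrableOn (fun u => (1 - cos u) * u ^ β) (Ioi 0) := by
  refine integrableOn_Ioi_of_rpow_bound (by fun_prop) (C := 2) (p := β + 2) (q := β)
    (by linarith) h2 (fun x hx _ => ?_) (fun x hx => ?_)
  · rw [abs_of_nonneg (mul_nonneg (one_sub_cos_nonneg x) (rpow_pos_of_pos hx _).le),
      rpow_add hx, rpow_two]
    have := one_sub_cos_le_sq x
    have hp := rpow_pos_of_pos hx β
    nlinarith [mul_le_mul_of_nonneg_right this hp.le, mul_nonneg (sq_nonneg x) hp.le]
  · have hx : 0 < x := by linarith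
    rw [abs_of_nonneg (mul_nonneg (one_sub_cos_nonneg x) (rpow_pos_of_pos hx _).le)]
    gcongr
    exact one_sub_cos_le_two x

lemma integral_one_sub_cos_mul_rpow_pos {β : ℝ} (h1 : -3 < β) (h2 : β < -1) :
    0 < ∫ u in Ioi (0 : ℝ), (1 - cos u) * u ^ β := by
  rw [setIntegral_pos_iff_support_of_nonneg_ae _ (integrableOn_one_sub_cos_mul_rpow h1 h2)]
  · refine lt_of_lt_of_le (b := volume (Ioo (0 : ℝ) 1)) (by simp) (measure_mono fun u hu => ?_)
    refine ⟨?_, hu.1⟩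
    have hc : cos u < 1 := by
      rw [← cos_zero]
      exact cos_lt_cos_of_nonneg_of_le_pi le_rfl (by linarith [hu.2, pi_gt_three]) hu.1
    exact (mul_pos (by linarith) (rpow_pos_of_pos hu.1 _)).ne'
  · exact (ae_restrict_iff' measurableSet_Ioi).2 (ae_of_all _ fun u hu =>
      mul_nonneg (one_sub_cos_nonneg u) (rpow_pos_of_pos hu _).le)

lemma integrableOn_sin_mul_rpow {β : ℝ} (h1 : -2 < β) (h2 : β < -1) :
    IntegrableOn (fun u => sin u * u ^ β) (Ioi 0) := by
  refine integrableOn_Ioi_of_rpow_bound (by fun_prop) (C := 1) (p := β + 1) (q := β)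
    (by linarith) h2 (fun x hx _ => ?_) (fun x hx => ?_)
  · rw [abs_mul, abs_of_pos (rpow_pos_of_pos hx _), rpow_add hx, rpow_one, one_mul, mul_comm]
    gcongr
    exact (abs_sin_le_abs).trans_eq (abs_of_pos hx)
  · have hx : 0 < x := by linarith
    rw [abs_mul, abs_of_pos (rpow_pos_of_pos hx _)]
    gcongr
    exact abs_sin_le_one x

/-- The sine changes sign, so positivity is not visible. The derivative of `(1 - cos u) u^β`
integrates to zero, which turns the integral into `-β` times that of `(1 - cos u) u^(β-1)`, and `-β
> 0`. -/
lemma integral_sin_mul_rpow_pos {β : ℝ} (h1 : -2 < β) (h2 : β < -1) :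
    0 < ∫ u in Ioi (0 : ℝ), sin u * u ^ β := by
  have hc := integrableOn_one_sub_cos_mul_rpow (β := β - 1) (by linarith) (by linarith)
  have hs := integrableOn_sin_mul_rpow h1 h2
  have h := integral_Ioi_deriv_eq_zero (F := fun u => (1 - cos u) * u ^ β)
    (f := fun u => sin u * u ^ β + β * ((1 - cos u) * u ^ (β - 1))) ?_ (hs.add (hc.const_mul β))
    (tendsto_zero_of_abs_le_rpow_nhdsGT (C := 1) (p := β + 2) (by linarith) ?_)
    (tendsto_zero_of_abs_le_rpow_atTop (C := 2) (p := β) (by linarith) ?_)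
  · rw [integral_add hs (hc.const_mul β), integral_const_mul] at h
    have := integral_one_sub_cos_mul_rpow_pos (β := β - 1) (by linarith) (by linarith)
    nlinarith
  · intro x hx
    refine (((hasDerivAt_cos x).const_sub 1).mul
      (hasDerivAt_rpow_const (p := β) (Or.inl hx.ne'))).congr_deriv ?_
    ring
  · intro x hx
    rw [abs_of_nonneg (mul_nonneg (one_sub_cos_nonneg x) (rpow_pos_of_pos hx _).le),
      rpow_add hx, rpow_two, one_mul, mul_comm]
    gcongr
    exact one_sub_cos_le_sq x
  · intro x hx
    rw [abs_of_nonneg (mul_nonneg (one_sub_cos_nonneg x) (rpow_pos_of_pos hx _).le)]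
    gcongr
    exact one_sub_cos_le_two x

/-! ### The function `(1 - exp (-s θ ^ α)) / θ ^ 2` -/

lemma one_sub_exp_neg_nonneg {x : ℝ} (hx : 0 ≤ x) : 0 ≤ 1 - exp (-x) := by
  linarith [exp_le_one_iff.2 (neg_nonpos.2 hx)]

lemma one_sub_exp_neg_le (x : ℝ) : 1 - exp (-x) ≤ x := by linarith [add_one_le_exp (-x)]

lemma one_sub_exp_neg_le_one (x : ℝ) : 1 - exp (-x) ≤ 1 := by linarith [exp_pos (-x)]

lemma tendsto_one_sub_exp_neg_div :
    Tendsto (fun x : ℝ => (1 - exp (-x)) / x) (𝓝[>] 0) (𝓝 1) := by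
  have hd : HasDerivAt (fun x : ℝ => 1 - exp (-x)) 1 0 := by
    simpa using ((hasDerivAt_id (0 : ℝ)).neg.exp).const_sub 1
  have := (hasDerivAt_iff_tendsto_slope_zero.1 hd).mono_left
    (nhdsWithin_mono 0 fun x (hx : 0 < x) => hx.ne')
  refine this.congr fun x => ?_
  simp [div_eq_inv_mul]

section Stable

variable {α s : ℝ}

lemma tendsto_mul_rpow_nhdsGT (hα : 0 < α) (hs : 0 < s) :
    Tendsto (fun θ : ℝ => s * θ ^ α) (𝓝[>] 0) (𝓝[>] 0) := by
  refine tendsto_nhdsWithin_iff.2 ⟨?_, ?_⟩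
  · have := ((continuousAt_rpow_const 0 α (Or.inr hα.le)).tendsto.const_mul s).mono_left
      (nhdsWithin_le_nhds (s := Ioi 0))
    simpa [zero_rpow hα.ne'] using this
  · filter_upwards [self_mem_nhdsWithin] with x hx using mul_pos hs (rpow_pos_of_pos hx _)

lemma tendsto_one_sub_exp_div_rpow (hα : 0 < α) (hs : 0 < s) :
    Tendsto (fun θ : ℝ => (1 - exp (-(s * θ ^ α))) / θ ^ α) (𝓝[>] 0) (𝓝 s) := by
  have := (tendsto_one_sub_exp_neg_div.comp (tendsto_mul_rpow_nhdsGT hα hs)).const_mul s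
  rw [mul_one] at this
  refine this.congr' ?_
  filter_upwards [self_mem_nhdsWithin] with x hx
  have := (rpow_pos_of_pos hx α).ne'
  simp only [Function.comp]
  field_simp

lemma abs_one_sub_exp_div_sq_le (hs : 0 < s) {θ : ℝ} (hθ : 0 < θ) :
    |(1 - exp (-(s * θ ^ α))) / θ ^ 2| ≤ s * θ ^ (α - 2) := by
  have hp := rpow_pos_of_pos hθ α
  rw [abs_of_nonneg (div_nonneg (one_sub_exp_neg_nonneg (by positivity)) (sq_nonneg _)),
    rpow_sub hθ, rpow_two, mul_div_assoc']
  gcongr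
  exact one_sub_exp_neg_le _

lemma abs_one_sub_exp_div_sq_le' (hs : 0 < s) {θ : ℝ} (hθ : 0 < θ) :
    |(1 - exp (-(s * θ ^ α))) / θ ^ 2| ≤ 1 * θ ^ (-2 : ℝ) := by
  have hp := rpow_pos_of_pos hθ α
  rw [abs_of_nonneg (div_nonneg (one_sub_exp_neg_nonneg (by positivity)) (sq_nonneg _)),
    rpow_neg hθ.le, rpow_two, ← div_eq_mul_inv]
  gcongr
  exact one_sub_exp_neg_le_one _

lemma integrableOn_one_sub_exp_div_sq (hα : 1 < α) (hs : 0 < s) :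
    IntegrableOn (fun θ => (1 - exp (-(s * θ ^ α))) / θ ^ 2) (Ioi 0) := by
  refine integrableOn_Ioi_of_rpow_bound (by fun_prop) (C := max s 1) (p := α - 2) (q := -2)
    (by linarith) (by norm_num) (fun x hx _ => ?_) (fun x hx => ?_)
  · refine (abs_one_sub_exp_div_sq_le hs hx).trans ?_
    gcongr
    exact le_max_left _ _
  · refine (abs_one_sub_exp_div_sq_le' hs (by linarith)).trans ?_
    gcongr
    exact le_max_right _ _

lemma hasDerivAt_exp_neg_mul_rpow {θ : ℝ} (hθ : 0 < θ) :
    HasDerivAt (fun θ => exp (-(s * θ ^ α))) (-(exp (-(s * θ ^ α)) * (s * (α * θ ^ (α - 1)))))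
      θ := by
  refine (((hasDerivAt_rpow_const (p := α) (Or.inl hθ.ne')).const_mul s).neg.exp).congr_deriv ?_
  change exp (-(s * θ ^ α)) * -(s * (α * θ ^ (α - 1))) = _
  ring

/-- Integration by parts: `(1 - exp (-s θ^α)) / θ` vanishes at both ends because `α > 1`, and what
remains is a Gamma integral. -/
lemma integral_one_sub_exp_div_sq (hα : 1 < α) (hs : 0 < s) :
    ∫ θ in Ioi (0 : ℝ), (1 - exp (-(s * θ ^ α))) / θ ^ 2 = s ^ (1 / α) * Gamma (1 - 1 / α) := by
  have hα0 : 0 < α := by linarith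
  have hi1 := integrableOn_one_sub_exp_div_sq hα hs
  have hi2 : IntegrableOn (fun θ : ℝ => θ ^ (α - 2) * exp (-s * θ ^ α)) (Ioi 0) :=
    integrableOn_rpow_mul_exp_neg_mul_rpow (by linarith) hα0 hs
  have h := integral_Ioi_deriv_eq_zero (F := fun θ => -((1 - exp (-(s * θ ^ α))) / θ))
    (f := fun θ => (1 - exp (-(s * θ ^ α))) / θ ^ 2 -
      s * α * (θ ^ (α - 2) * exp (-s * θ ^ α))) ?_ (hi1.sub (hi2.const_mul _))
    (tendsto_zero_of_abs_le_rpow_nhdsGT (C := s) (p := α - 1) (by linarith) ?_)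
    (tendsto_zero_of_abs_le_rpow_atTop (C := 1) (p := -1) (by norm_num) ?_)
  · rw [integral_sub hi1 (hi2.const_mul _), integral_const_mul,
      integral_rpow_mul_exp_neg_mul_rpow hα0 (by linarith) hs, sub_eq_zero] at h
    rw [h]
    have e1 : (α - 2 + 1) / α = 1 - 1 / α := by field_simp; ring
    have e2 : s ^ (1 / α) = s * s ^ (-(α - 2 + 1) / α) := by
      nth_rewrite 2 [← rpow_one s]
      rw [← rpow_add hs]
      congr 1
      field_simp
      ring
    rw [e1, e2]
    field_simp
  · intro x hx
    refine (((hasDerivAt_exp_neg_mul_rpow hx).const_sub 1).div (hasDerivAt_id x)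
      hx.ne').neg.congr_deriv ?_
    rw [rpow_sub hx, rpow_sub hx, rpow_one, rpow_two, neg_mul]
    simp only [id]
    field_simp
    ring
  · intro x hx
    have hp := rpow_pos_of_pos hx α
    rw [abs_neg, abs_of_nonneg (div_nonneg (one_sub_exp_neg_nonneg (by positivity)) hx.le),
      rpow_sub hx, rpow_one, mul_div_assoc']
    gcongr
    exact one_sub_exp_neg_le _
  · intro x hx
    have hp := rpow_pos_of_pos hx α
    rw [abs_neg, abs_of_nonneg (div_nonneg (one_sub_exp_neg_nonneg (by positivity)) hx.le),
      rpow_neg hx.le, rpow_one, ← div_eq_mul_inv]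
    gcongr
    exact one_sub_exp_neg_le_one _

/-- The case `α < 1`. -/
lemma tendsto_rpow_mul_integral_of_lt_one (hα0 : 0 < α) (hα : α < 1) (hs : 0 < s) :
    Tendsto (fun L => L ^ (α - 1) *
        ∫ θ in Ioi (0 : ℝ), (1 - cos (θ * L)) * ((1 - exp (-(s * θ ^ α))) / θ ^ 2)) atTop
      (𝓝 (s * ∫ u in Ioi (0 : ℝ), (1 - cos u) * u ^ (α - 2))) := by
  -- Rescaling works directly, since `α < 1` makes `(1 - cos u) u^(α-2)` integrable at infinity.
  have h := tendsto_rpow_mul_integral_comp_mul (w := fun u => 1 - cos u) (by fun_prop)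
    (K := fun θ => (1 - exp (-(s * θ ^ α))) / θ ^ 2) (by fun_prop) (β := α - 2)
    (integrableOn_one_sub_cos_mul_rpow (by linarith) (by linarith))
    (fun θ hθ => abs_one_sub_exp_div_sq_le hs hθ) (A := s) ?_
  · convert h using 4
    ring
  · refine (tendsto_one_sub_exp_div_rpow hα0 hs).congr' ?_
    filter_upwards [self_mem_nhdsWithin] with x hx
    have hx : 0 < x := hx
    rw [rpow_sub hx, rpow_two]
    field_simp

/-- The case `1 < α < 2`. -/
lemma tendsto_rpow_mul_integral_cos (hα1 : 1 < α) (hα2 : α < 2) (hs : 0 < s) :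
    Tendsto (fun L => L ^ (α - 1) *
        ∫ θ in Ioi (0 : ℝ), cos (θ * L) * ((1 - exp (-(s * θ ^ α))) / θ ^ 2)) atTop
      (𝓝 (s * (2 - α) * ∫ u in Ioi (0 : ℝ), sin u * u ^ (α - 3))) := by
  have hα0 : 0 < α := by linarith
  -- The weight `cos u * u^(α-2)` is not absolutely integrable at infinity for `α > 1`. One
  -- integration by parts replaces it by `sin u * u^(α-3)`, which is, so the rescaling lemma is
  -- applied to `h'`, with `h' θ ~ s (α - 2) θ^(α-3)` at `0`.
  let h : ℝ → ℝ := fun θ => (1 - exp (-(s * θ ^ α))) / θ ^ 2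
  let h' : ℝ → ℝ := fun θ =>
    exp (-(s * θ ^ α)) * (s * (α * θ ^ (α - 3))) - 2 * ((1 - exp (-(s * θ ^ α))) / θ ^ 3)
  have h'm : Measurable h' := by fun_prop
  have hd : ∀ x, 0 < x → HasDerivAt h (h' x) x := by
    intro x hx
    refine (((hasDerivAt_exp_neg_mul_rpow hx).const_sub 1).div (hasDerivAt_pow 2 x)
      (by positivity)).congr_deriv ?_
    have e : x ^ (α - 1) = x ^ (α - 3) * x ^ 2 := by
      rw [← rpow_two, ← rpow_add hx]; congr 1; ring
    simp only [h']
    rw [e]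
    field_simp
    push_cast
    ring
  have hb : ∀ θ, 0 < θ → |h' θ| ≤ (s * α + 2 * s) * θ ^ (α - 3) := by
    intro x hx
    have hp := rpow_pos_of_pos hx α
    have hp3 := rpow_pos_of_pos hx (α - 3)
    have h1 : |exp (-(s * x ^ α)) * (s * (α * x ^ (α - 3)))| ≤ 1 * (s * (α * x ^ (α - 3))) := by
      rw [abs_of_pos (by positivity)]
      gcongr
      exact exp_le_one_iff.2 (by linarith [mul_pos hs hp])
    have h2 : |2 * ((1 - exp (-(s * x ^ α))) / x ^ 3)| ≤ 2 * (s * x ^ (α - 3)) := by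
      rw [abs_of_nonneg (mul_nonneg two_pos.le (div_nonneg (one_sub_exp_neg_nonneg
        (by positivity)) (by positivity))), rpow_sub hx]
      have : x ^ (3 : ℝ) = x ^ 3 := by exact_mod_cast rpow_natCast x 3
      rw [this, ← mul_div_assoc s]
      gcongr
      exact one_sub_exp_neg_le _
    calc |h' x| ≤ _ := abs_sub _ _
      _ ≤ _ := add_le_add h1 h2
      _ = _ := by ring
  have hl : Tendsto (fun θ => h' θ / θ ^ (α - 3)) (𝓝[>] 0) (𝓝 (s * (α - 2))) := by
    have he : Tendsto (fun θ : ℝ => exp (-(s * θ ^ α))) (𝓝[>] 0) (𝓝 1) := by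
      have := ((tendsto_mul_rpow_nhdsGT hα0 hs).mono_right nhdsWithin_le_nhds).neg
      have := (continuous_exp.tendsto _).comp this
      rwa [neg_zero, exp_zero] at this
    have := (he.mul_const (s * α)).sub ((tendsto_one_sub_exp_div_rpow hα0 hs).const_mul 2)
    have e : 1 * (s * α) - 2 * s = s * (α - 2) := by ring
    rw [e] at this
    refine this.congr' ?_
    filter_upwards [self_mem_nhdsWithin] with x hx
    have hx : 0 < x := hx
    have hp := rpow_pos_of_pos hx (α - 3)
    have e : x ^ α = x ^ (α - 3) * x ^ 3 := by
      rw [← rpow_natCast, ← rpow_add hx]; congr 1; push_cast; ring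
    simp only [h']
    generalize exp (-(s * x ^ α)) = E
    rw [e]
    field_simp
  have key := tendsto_rpow_mul_integral_comp_mul (w := sin) (by fun_prop) h'm (β := α - 3)
    (integrableOn_sin_mul_rpow (by linarith) (by linarith)) hb hl
  have key' := key.neg
  have e : -(s * (α - 2) * ∫ u in Ioi (0 : ℝ), sin u * u ^ (α - 3)) =
    s * (2 - α) * ∫ u in Ioi (0 : ℝ), sin u * u ^ (α - 3) := by ring
  rw [e] at key'
  refine key'.congr' ?_
  filter_upwards [eventually_gt_atTop 0] with L hL
  have hi1 : IntegrableOn (fun θ => cos (θ * L) * h θ) (Ioi 0) := by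
    refine Integrable.mono (g := h) (integrableOn_one_sub_exp_div_sq hα1 hs)
      (Measurable.aestronglyMeasurable (by fun_prop)) (ae_of_all _ fun x => ?_)
    rw [norm_mul]
    exact mul_le_of_le_one_left (norm_nonneg _) (abs_cos_le_one _)
  have hi2 : IntegrableOn (fun θ => sin (θ * L) * h' θ) (Ioi 0) := by
    -- The factor `L + 1` covers both `|sin (xL)| ≤ Lx` near `0` and `|sin (xL)| ≤ 1` at infinity.
    refine integrableOn_Ioi_of_rpow_bound (by fun_prop) (C := (L + 1) * (s * α + 2 * s))
      (p := α - 2) (q := α - 3) (by linarith) (by linarith) (fun x hx _ => ?_) (fun x hx => ?_)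
    · have e : x ^ (α - 2) = x * x ^ (α - 3) := by
        nth_rewrite 2 [← rpow_one x]
        rw [← rpow_add hx]; congr 1; ring
      have hs1 : |sin (x * L)| ≤ (L + 1) * x := by
        refine (abs_sin_le_abs).trans ?_
        rw [abs_of_pos (by positivity)]
        nlinarith
      rw [abs_mul, e]
      calc |sin (x * L)| * |h' x| ≤ ((L + 1) * x) * ((s * α + 2 * s) * x ^ (α - 3)) := by
            gcongr
            exact hb x hx
        _ = _ := by ring
    · have hx : 0 < x := by linarith
      rw [abs_mul, mul_assoc]
      refine mul_le_mul ?_ (hb x hx) (abs_nonneg _) (by positivity)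
      linarith [abs_sin_le_one (x * L)]
  -- The boundary term vanishes at both ends, so `L` times the cosine integral is minus the sine
  -- integral.
  have h0 := integral_Ioi_deriv_eq_zero (F := fun θ => sin (θ * L) * h θ)
    (f := fun θ => L * (cos (θ * L) * h θ) + sin (θ * L) * h' θ) ?_
    ((hi1.const_mul L).add hi2)
    (tendsto_zero_of_abs_le_rpow_nhdsGT (C := L * s) (p := α - 1) (by linarith) ?_)
    (tendsto_zero_of_abs_le_rpow_atTop (C := 1) (p := -2) (by norm_num) ?_)
  · rw [integral_add (hi1.const_mul L) hi2, integral_const_mul] at h0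
    have e1 : L ^ (α - 1) = L ^ (1 + (α - 3)) * L := by
      nth_rewrite 3 [← rpow_one L]
      rw [← rpow_add hL]; congr 1; ring
    rw [e1, mul_assoc, ← mul_neg]
    congr 1
    linarith
  · intro x hx
    have : HasDerivAt (fun θ => sin (θ * L)) (cos (x * L) * L) x := by
      simpa using ((hasDerivAt_id x).mul_const L).sin
    refine (this.mul (hd x hx)).congr_deriv ?_
    ring
  · intro x hx
    have e : x ^ (α - 1) = x * x ^ (α - 2) := by
      nth_rewrite 2 [← rpow_one x]
      rw [← rpow_add hx]; congr 1; ring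
    have hs1 : |sin (x * L)| ≤ L * x := by
      refine (abs_sin_le_abs).trans ?_
      rw [abs_of_pos (by positivity), mul_comm]
    rw [abs_mul, e]
    calc |sin (x * L)| * |h x| ≤ (L * x) * (s * x ^ (α - 2)) := by
          gcongr
          exact abs_one_sub_exp_div_sq_le hs hx
      _ = _ := by ring
  · intro x hx
    rw [abs_mul]
    exact mul_le_mul (abs_sin_le_one _) (by simpa using abs_one_sub_exp_div_sq_le' hs hx)
      (abs_nonneg _) zero_le_one

end Stable

/-! ### The case `α = 1` -/

lemma lintegral_exp_neg_mul_Ioi_one {θ : ℝ} (hθ : 0 < θ) :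
    ∫⁻ x in Ioi (1 : ℝ), ENNReal.ofReal (exp (-(x * θ))) = ENNReal.ofReal (exp (-θ) / θ) := by
  have hd : ∀ x ∈ Ici (1 : ℝ), HasDerivAt (fun x => -(exp (-(x * θ)) / θ)) (exp (-(x * θ))) x := by
    intro x _
    have he : HasDerivAt (fun x => exp (-(x * θ))) (exp (-(x * θ)) * (-θ)) x := by
      have := ((hasDerivAt_id x).mul_const θ).neg.exp
      simpa using this
    refine (he.div_const θ).neg.congr_deriv ?_
    field_simp
  have hpos : ∀ x ∈ Ioi (1 : ℝ), 0 ≤ exp (-(x * θ)) := fun x _ => (exp_pos _).le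
  have hlim : Tendsto (fun x => -(exp (-(x * θ)) / θ)) atTop (𝓝 0) := by
    have := ((tendsto_exp_neg_mul_atTop hθ).div_const θ).neg
    simpa [mul_comm] using this
  rw [← ofReal_integral_eq_lintegral_ofReal (integrableOn_Ioi_deriv_of_nonneg' hd hpos hlim)
    ((ae_restrict_iff' measurableSet_Ioi).2 (ae_of_all _ hpos)),
    integral_Ioi_of_hasDerivAt_of_nonneg' hd hpos hlim]
  simp

lemma integrableOn_one_sub_cos_mul_mul_exp {x L : ℝ} (hx : 0 < x) (hL : 0 < L) :
    IntegrableOn (fun θ => (1 - cos (θ * L)) * exp (-(x * θ))) (Ioi 0) ∧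
      ∫ θ in Ioi (0 : ℝ), (1 - cos (θ * L)) * exp (-(x * θ)) = L ^ 2 / (x * (x ^ 2 + L ^ 2)) := by
  obtain ⟨hi, he⟩ := integrableOn_one_sub_cos_mul_exp (div_pos hx hL)
  have heq : (fun θ => (1 - cos (θ * L)) * exp (-(x * θ))) = fun θ => L / x *
      ((1 - cos (L * θ)) * (x / L * exp (-(x / L * (L * θ))))) := by
    ext θ
    rw [← mul_assoc (x / L), div_mul_cancel₀ _ hL.ne', mul_comm θ L]
    field_simp
  have hi' := (integrableOn_Ioi_comp_mul_left_iff
    (fun u => (1 - cos u) * (x / L * exp (-(x / L * u)))) 0 hL).2 (by rwa [mul_zero])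
  have he' := integral_comp_mul_left_Ioi
    (fun u => (1 - cos u) * (x / L * exp (-(x / L * u)))) 0 hL
  rw [mul_zero, he, smul_eq_mul] at he'
  rw [heq]
  refine ⟨hi'.const_mul _, ?_⟩
  rw [integral_const_mul, he']
  field_simp
  ring

lemma lintegral_sq_div_mul_Ioi_one (L : ℝ) :
    ∫⁻ x in Ioi (1 : ℝ), ENNReal.ofReal (L ^ 2 / (x * (x ^ 2 + L ^ 2))) =
      ENNReal.ofReal (1 / 2 * log (1 + L ^ 2)) := by
  have hd : ∀ x ∈ Ici (1 : ℝ), HasDerivAt (fun x => -(1 / 2 * log (1 + L ^ 2 * (x ^ 2)⁻¹)))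
      (L ^ 2 / (x * (x ^ 2 + L ^ 2))) x := by
    intro x hx
    have hx : (0 : ℝ) < x := lt_of_lt_of_le one_pos hx
    have h1 : HasDerivAt (fun x : ℝ => 1 + L ^ 2 * (x ^ 2)⁻¹)
        (L ^ 2 * (-(2 * x) / (x ^ 2) ^ 2)) x := by
      have := (((hasDerivAt_pow 2 x).inv (by positivity)).const_mul (L ^ 2)).const_add 1
      simpa using this
    refine ((h1.log (by positivity)).const_mul (1 / 2)).neg.congr_deriv ?_
    field_simp
  have hpos : ∀ x ∈ Ioi (1 : ℝ), 0 ≤ L ^ 2 / (x * (x ^ 2 + L ^ 2)) := fun x hx => by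
    have hx : (0 : ℝ) < x := lt_trans one_pos hx
    positivity
  have hlim : Tendsto (fun x => -(1 / 2 * log (1 + L ^ 2 * (x ^ 2)⁻¹))) atTop (𝓝 0) := by
    have h1 : Tendsto (fun x : ℝ => 1 + L ^ 2 * (x ^ 2)⁻¹) atTop (𝓝 (1 + L ^ 2 * 0)) :=
      (((tendsto_pow_atTop two_ne_zero).inv_tendsto_atTop).const_mul _).const_add 1
    have h2 := ((h1.log (by simp)).const_mul (1 / 2)).neg
    simpa using h2
  rw [← ofReal_integral_eq_lintegral_ofReal (integrableOn_Ioi_deriv_of_nonneg' hd hpos hlim)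
    ((ae_restrict_iff' measurableSet_Ioi).2 (ae_of_all _ hpos)),
    integral_Ioi_of_hasDerivAt_of_nonneg' hd hpos hlim]
  simp

/-- Frullani's trick: `exp (-θ) / θ` is the integral of `exp (-xθ)` over `x > 1`, and Tonelli leaves
the rational function `L² / (x (x² + L²))`. -/
lemma integrableOn_one_sub_cos_mul_exp_div {L : ℝ} (hL : 0 < L) :
    IntegrableOn (fun θ => (1 - cos (θ * L)) * (exp (-θ) / θ)) (Ioi 0) ∧
      ∫ θ in Ioi (0 : ℝ), (1 - cos (θ * L)) * (exp (-θ) / θ) = 1 / 2 * log (1 + L ^ 2) := by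
  have h1 : ∀ θ ∈ Ioi (0 : ℝ), ENNReal.ofReal ((1 - cos (θ * L)) * (exp (-θ) / θ)) =
      ∫⁻ x in Ioi (1 : ℝ), ENNReal.ofReal ((1 - cos (θ * L)) * exp (-(x * θ))) := by
    intro θ hθ
    simp_rw [ENNReal.ofReal_mul (one_sub_cos_nonneg (θ * L))]
    rw [lintegral_const_mul _ (by fun_prop), lintegral_exp_neg_mul_Ioi_one hθ]
  have h2 : ∀ x ∈ Ioi (1 : ℝ),
      ∫⁻ θ in Ioi (0 : ℝ), ENNReal.ofReal ((1 - cos (θ * L)) * exp (-(x * θ))) =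
        ENNReal.ofReal (L ^ 2 / (x * (x ^ 2 + L ^ 2))) := by
    intro x hx
    obtain ⟨hi, he⟩ := integrableOn_one_sub_cos_mul_mul_exp (lt_trans one_pos hx) hL
    rw [← he, ofReal_integral_eq_lintegral_ofReal hi]
    filter_upwards with u
    exact mul_nonneg (one_sub_cos_nonneg _) (exp_pos _).le
  have key : ∫⁻ θ in Ioi (0 : ℝ), ENNReal.ofReal ((1 - cos (θ * L)) * (exp (-θ) / θ)) =
      ENNReal.ofReal (1 / 2 * log (1 + L ^ 2)) := by
    rw [setLIntegral_congr_fun measurableSet_Ioi h1, lintegral_lintegral_swap (by fun_prop),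
      setLIntegral_congr_fun measurableSet_Ioi h2, lintegral_sq_div_mul_Ioi_one]
  have hpos : 0 ≤ᵐ[volume.restrict (Ioi (0 : ℝ))]
      fun θ => (1 - cos (θ * L)) * (exp (-θ) / θ) :=
    (ae_restrict_iff' measurableSet_Ioi).2 (ae_of_all _ fun θ hθ =>
      mul_nonneg (one_sub_cos_nonneg _) (div_nonneg (exp_pos _).le (le_of_lt hθ)))
  constructor
  · refine ⟨Measurable.aestronglyMeasurable (by fun_prop), ?_⟩
    rw [hasFiniteIntegral_iff_ofReal hpos, key]
    exact ENNReal.ofReal_lt_top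
  · rw [integral_eq_lintegral_of_nonneg_ae hpos (Measurable.aestronglyMeasurable (by fun_prop)),
      key, ENNReal.toReal_ofReal]
    exact mul_nonneg (by norm_num) (log_nonneg (by nlinarith))

/-- Both terms have the singularity `s/θ` at `0`, so the difference is bounded there; at infinity it
is of order `θ^(-2)`. -/
lemma integrableOn_one_sub_exp_div_sq_sub {s : ℝ} (hs : 0 < s) :
    IntegrableOn (fun θ => (1 - exp (-(s * θ))) / θ ^ 2 - s * (exp (-θ) / θ)) (Ioi 0) := by
  refine integrableOn_Ioi_of_rpow_bound (by fun_prop) (C := s ^ 2 + s + 1) (p := 0) (q := -2)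
    (by norm_num) (by norm_num) (fun x hx _ => ?_) (fun x hx => ?_)
  · have h1 : 0 ≤ s * x - (1 - exp (-(s * x))) := by linarith [one_sub_exp_neg_le (s * x)]
    have h2 : s * x - (1 - exp (-(s * x))) ≤ s ^ 2 * x ^ 2 := by
      -- The second-order bound follows from `exp (-y) ≤ 1/(1 + y) ≤ 1 - y + y²` with `y = s x`.
      have h3 : 0 < s * x := by positivity
      have h4 : exp (-(s * x)) ≤ (1 + s * x)⁻¹ := by
        rw [exp_neg]
        gcongr
        linarith [add_one_le_exp (s * x)]
      have h5 : (1 + s * x)⁻¹ ≤ 1 - s * x + (s * x) ^ 2 := by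
        rw [inv_le_iff_one_le_mul₀ (by positivity)]
        nlinarith [pow_pos h3 3]
      nlinarith
    have e : (1 - exp (-(s * x))) / x ^ 2 - s * (exp (-x) / x) =
        s * ((1 - exp (-x)) / x) - (s * x - (1 - exp (-(s * x)))) / x ^ 2 := by
      field_simp
      ring
    rw [e, rpow_zero, mul_one]
    have h6 : (1 - exp (-x)) / x ≤ 1 := by
      rw [div_le_one hx]
      exact one_sub_exp_neg_le x
    have h7 : 0 ≤ (1 - exp (-x)) / x := div_nonneg (one_sub_exp_neg_nonneg hx.le) hx.le
    have h8 : (s * x - (1 - exp (-(s * x)))) / x ^ 2 ≤ s ^ 2 := by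
      rw [div_le_iff₀ (by positivity)]
      exact h2
    have h9 : 0 ≤ (s * x - (1 - exp (-(s * x)))) / x ^ 2 := div_nonneg h1 (by positivity)
    rw [abs_le]
    constructor <;> nlinarith
  · have hx0 : 0 < x := by linarith
    have h1 : 0 ≤ (1 - exp (-(s * x))) / x ^ 2 :=
      div_nonneg (one_sub_exp_neg_nonneg (by positivity)) (by positivity)
    have h2 : (1 - exp (-(s * x))) / x ^ 2 ≤ 1 / x ^ 2 := by
      gcongr
      exact one_sub_exp_neg_le_one _
    have h3 : exp (-x) / x ≤ 1 / x ^ 2 := by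
      rw [div_le_div_iff₀ hx0 (by positivity), exp_neg]
      have : x < exp x := by linarith [add_one_le_exp x]
      have := (inv_mul_le_one₀ (exp_pos x)).2 this.le
      nlinarith
    have h4 : 0 ≤ exp (-x) / x := by positivity
    rw [rpow_neg hx0.le, rpow_two, ← one_div]
    have h5 : 0 < 1 / x ^ 2 := by positivity
    rw [abs_le]
    constructor <;> nlinarith [mul_le_mul_of_nonneg_left h3 hs.le, mul_nonneg hs.le h4,
      mul_pos (pow_pos hs 2) h5, mul_pos hs h5]

/-- Replacing the kernel by `s exp (-θ)/θ` costs at most `B`, uniformly in `L`; the explicit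
integral differs from `log L` by at most `(log 2)/2` for `L ≥ 1`. -/
lemma tendsto_integral_div_log {s : ℝ} (hs : 0 < s) :
    Tendsto (fun L => (∫ θ in Ioi (0 : ℝ), (1 - cos (θ * L)) * ((1 - exp (-(s * θ))) / θ ^ 2)) /
      log L) atTop (𝓝 s) := by
  let d : ℝ → ℝ := fun θ => (1 - exp (-(s * θ))) / θ ^ 2 - s * (exp (-θ) / θ)
  have hd : IntegrableOn d (Ioi 0) := integrableOn_one_sub_exp_div_sq_sub hs
  let B : ℝ := ∫ θ in Ioi (0 : ℝ), 2 * |d θ|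
  have hbound : ∀ L : ℝ, 1 ≤ L →
      |(∫ θ in Ioi (0 : ℝ), (1 - cos (θ * L)) * ((1 - exp (-(s * θ))) / θ ^ 2)) - s * log L| ≤
        B + s * (1 / 2 * log 2) := by
    intro L hL
    have hL0 : 0 < L := by linarith
    obtain ⟨hi, he⟩ := integrableOn_one_sub_cos_mul_exp_div hL0
    have hle : ∀ θ, ‖(1 - cos (θ * L)) * d θ‖ ≤ 2 * |d θ| := fun θ => by
      rw [norm_mul, norm_eq_abs, norm_eq_abs, abs_of_nonneg (one_sub_cos_nonneg _)]
      gcongr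
      exact one_sub_cos_le_two _
    have hi2 : IntegrableOn (fun θ => (1 - cos (θ * L)) * d θ) (Ioi 0) :=
      (hd.abs.const_mul 2).mono' (Measurable.aestronglyMeasurable (by fun_prop))
        (ae_of_all _ hle)
    have hB : |∫ θ in Ioi (0 : ℝ), (1 - cos (θ * L)) * d θ| ≤ B :=
      norm_integral_le_of_norm_le (hd.abs.const_mul 2) (ae_of_all _ hle)
    have hsplit : ∫ θ in Ioi (0 : ℝ), (1 - cos (θ * L)) * ((1 - exp (-(s * θ))) / θ ^ 2) =
        (∫ θ in Ioi (0 : ℝ), (1 - cos (θ * L)) * d θ) + s * (1 / 2 * log (1 + L ^ 2)) := by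
      rw [← he, ← integral_const_mul, ← integral_add hi2 (hi.const_mul s)]
      congr 1 with θ
      simp only [d]
      ring
    have hlog : 1 / 2 * log (1 + L ^ 2) = log L + 1 / 2 * log (1 + (L ^ 2)⁻¹) := by
      have : 1 + L ^ 2 = L ^ 2 * (1 + (L ^ 2)⁻¹) := by field_simp; ring
      rw [this, log_mul (by positivity) (by positivity), log_pow]
      push_cast
      ring
    have hl0 : 0 ≤ log (1 + (L ^ 2)⁻¹) := log_nonneg (by
      have : 0 < (L ^ 2)⁻¹ := by positivity
      linarith)
    have hl1 : log (1 + (L ^ 2)⁻¹) ≤ log 2 := by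
      refine log_le_log (by positivity) ?_
      have : (L ^ 2)⁻¹ ≤ 1 := inv_le_one_of_one_le₀ (by nlinarith)
      linarith
    rw [hsplit, hlog]
    calc _ = |(∫ θ in Ioi (0 : ℝ), (1 - cos (θ * L)) * d θ) +
          s * (1 / 2 * log (1 + (L ^ 2)⁻¹))| := by congr 1; ring
      _ ≤ _ := abs_add_le _ _
      _ ≤ _ := by
        rw [abs_of_nonneg (by positivity : 0 ≤ s * (1 / 2 * log (1 + (L ^ 2)⁻¹)))]
        gcongr
  have hz : Tendsto (fun L => ((∫ θ in Ioi (0 : ℝ), (1 - cos (θ * L)) *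
      ((1 - exp (-(s * θ))) / θ ^ 2)) - s * log L) / log L) atTop (𝓝 0) := by
    refine squeeze_zero_norm' ?_
      ((tendsto_const_nhds (x := B + s * (1 / 2 * log 2))).div_atTop tendsto_log_atTop)
    filter_upwards [eventually_gt_atTop 1] with L hL
    have := log_pos hL
    rw [norm_div, norm_eq_abs, norm_eq_abs, abs_of_pos this]
    gcongr
    exact hbound L hL.le
  have := hz.add_const s
  rw [zero_add] at this
  refine this.congr' ?_
  filter_upwards [eventually_gt_atTop 1] with L hL
  rw [sub_div, mul_div_cancel_right₀ _ (log_pos hL).ne', sub_add_cancel]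

/-! ### The Gaussian case -/

/-- The excess over `L` is `(y - L)⁺ + (-y - L)⁺`. Translating each part by `L` and using `(|y| +
L)² ≥ y² + L²` extracts the exponential from the density; the factor `2` counts the two tails. -/
lemma integral_abs_sub_min_gaussianReal_le {v : ℝ≥0} (hv : v ≠ 0) {L : ℝ} (hL : 0 ≤ L) :
    ∫ y, (|y| - min |y| L) ∂(gaussianReal 0 v) ≤
      exp (-L ^ 2 / (2 * v)) * (2 * ∫ y, |y| ∂(gaussianReal 0 v)) := by
  have hv0 : (0 : ℝ) < v := by positivity
  have habs : Integrable (fun y : ℝ => |y|) (gaussianReal 0 v) :=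
    (memLp_id_gaussianReal 1).integrable le_rfl |>.abs
  have hI : Integrable (fun y => gaussianPDFReal 0 v y * |y|) volume := by
    have := (integrable_withDensity_iff_integrable_smul' (μ := volume)
      (measurable_gaussianPDF 0 v) (ae_of_all _ fun x => gaussianPDF_lt_top)
      (g := fun y : ℝ => |y|)).1 (by
        rwa [← gaussianReal_of_var_ne_zero 0 hv])
    simpa using this
  let E : ℝ := exp (-L ^ 2 / (2 * v))
  have hpdf : ∀ y : ℝ, 0 ≤ y → gaussianPDFReal 0 v (y + L) ≤ E * gaussianPDFReal 0 v y := by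
    intro y hy
    simp only [gaussianPDFReal, sub_zero]
    rw [mul_left_comm, ← exp_add]
    gcongr
    rw [← add_div]
    gcongr
    nlinarith
  have hpdf' : ∀ y : ℝ, y ≤ 0 → gaussianPDFReal 0 v (y - L) ≤ E * gaussianPDFReal 0 v y := by
    intro y hy
    simp only [gaussianPDFReal, sub_zero]
    rw [mul_left_comm, ← exp_add]
    gcongr
    rw [← add_div]
    gcongr
    nlinarith
  have hp0 := fun y => gaussianPDFReal_nonneg 0 v y
  have b1 : ∀ y : ℝ, gaussianPDFReal 0 v (y + L) * max (y + L - L) 0 ≤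
      E * (gaussianPDFReal 0 v y * |y|) := by
    intro y
    rw [add_sub_cancel_right]
    rcases le_total 0 y with h | h
    · rw [max_eq_left h, abs_of_nonneg h, ← mul_assoc]
      exact mul_le_mul_of_nonneg_right (hpdf y h) h
    · rw [max_eq_right h, mul_zero]
      have := hp0 y
      positivity
  have b2 : ∀ y : ℝ, gaussianPDFReal 0 v (y - L) * max (-(y - L) - L) 0 ≤
      E * (gaussianPDFReal 0 v y * |y|) := by
    intro y
    rw [show -(y - L) - L = -y by ring]
    rcases le_total 0 y with h | h
    · rw [max_eq_right (by linarith), mul_zero]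
      have := hp0 y
      positivity
    · rw [max_eq_left (by linarith), abs_of_nonpos h, ← mul_assoc]
      exact mul_le_mul_of_nonneg_right (hpdf' y h) (by linarith)
  have i1 : Integrable (fun y => gaussianPDFReal 0 v (y + L) * max (y + L - L) 0) volume := by
    refine (hI.const_mul E).mono' (Measurable.aestronglyMeasurable (by fun_prop))
      (ae_of_all _ fun y => ?_)
    rw [norm_eq_abs, abs_of_nonneg (mul_nonneg (hp0 _) (le_max_right _ _))]
    exact b1 y
  have i2 : Integrable (fun y => gaussianPDFReal 0 v (y - L) * max (-(y - L) - L) 0) volume := by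
    refine (hI.const_mul E).mono' (Measurable.aestronglyMeasurable (by fun_prop))
      (ae_of_all _ fun y => ?_)
    rw [norm_eq_abs, abs_of_nonneg (mul_nonneg (hp0 _) (le_max_right _ _))]
    exact b2 y
  have j1 : Integrable (fun y => gaussianPDFReal 0 v y * max (y - L) 0) volume := by
    simpa using i1.comp_sub_right L
  have j2 : Integrable (fun y => gaussianPDFReal 0 v y * max (-y - L) 0) volume := by
    simpa using i2.comp_add_right L
  have c1 : ∫ y, gaussianPDFReal 0 v y * max (y - L) 0 ≤
      E * ∫ y, gaussianPDFReal 0 v y * |y| := by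
    rw [← integral_const_mul,
      ← integral_add_right_eq_self (fun y => gaussianPDFReal 0 v y * max (y - L) 0) L]
    exact integral_mono i1 (hI.const_mul E) b1
  have c2 : ∫ y, gaussianPDFReal 0 v y * max (-y - L) 0 ≤
      E * ∫ y, gaussianPDFReal 0 v y * |y| := by
    rw [← integral_const_mul,
      ← integral_sub_right_eq_self (fun y => gaussianPDFReal 0 v y * max (-y - L) 0) L]
    exact integral_mono i2 (hI.const_mul E) b2
  rw [integral_gaussianReal_eq_integral_smul hv, integral_gaussianReal_eq_integral_smul hv]
  simp only [smul_eq_mul]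
  have heq : ∀ y : ℝ, gaussianPDFReal 0 v y * (|y| - min |y| L) =
      gaussianPDFReal 0 v y * max (y - L) 0 + gaussianPDFReal 0 v y * max (-y - L) 0 := by
    intro y
    rw [← mul_add]
    congr 1
    rcases le_total 0 y with h | h
    · rw [abs_of_nonneg h, max_eq_right (a := -y - L) (by linarith), add_zero]
      rcases le_total y L with h' | h'
      · rw [min_eq_left h', max_eq_right (by linarith), sub_self]
      · rw [min_eq_right h', max_eq_left (by linarith)]
    · rw [abs_of_nonpos h, max_eq_right (a := y - L) (by linarith), zero_add]
      rcases le_total (-y) L with h' | h'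
      · rw [min_eq_left h', max_eq_right (by linarith), sub_self]
      · rw [min_eq_right h', max_eq_left (by linarith)]
  simp_rw [heq]
  rw [integral_add j1 j2]
  change _ ≤ E * _
  linarith

/-! ### Truncated first moments of symmetric stable laws -/

section StableLaw

variable {α s : ℝ} {ρ : Measure ℝ} [IsProbabilityMeasure ρ]

lemma integral_min_abs_of_stable
    (hρ : ∀ θ, charFun ρ θ = ((exp (-(s * |θ| ^ α)) : ℝ) : ℂ)) {L : ℝ} (hL : 0 ≤ L) :
    ∫ y, min |y| L ∂ρ = 2 / π *
      ∫ θ in Ioi (0 : ℝ), (1 - cos (θ * L)) * ((1 - exp (-(s * θ ^ α))) / θ ^ 2) := by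
  rw [integral_min_abs_of_charFun (φ := fun θ => exp (-(s * |θ| ^ α))) hρ hL]
  congr 1
  refine setIntegral_congr_fun measurableSet_Ioi fun θ hθ => ?_
  simp only [abs_of_pos (show 0 < θ from hθ), mul_div_assoc]

lemma integrable_abs_of_stable (hα : 1 < α) (hs : 0 < s)
    (hρ : ∀ θ, charFun ρ θ = ((exp (-(s * |θ| ^ α)) : ℝ) : ℂ)) :
    Integrable (fun y => |y|) ρ ∧
      ∫ y, |y| ∂ρ = 2 / π * (s ^ (1 / α) * Gamma (1 - 1 / α)) := by
  have heq : EqOn (fun θ => (1 - exp (-(s * |θ| ^ α))) / θ ^ 2)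
      (fun θ => (1 - exp (-(s * θ ^ α))) / θ ^ 2) (Ioi 0) := fun θ hθ => by
    simp only [abs_of_pos (show 0 < θ from hθ)]
  have h := integrable_abs_of_charFun (φ := fun θ => exp (-(s * |θ| ^ α))) hρ
    ((integrableOn_congr_fun heq measurableSet_Ioi).2 (integrableOn_one_sub_exp_div_sq hα hs))
  rwa [setIntegral_congr_fun measurableSet_Ioi heq, integral_one_sub_exp_div_sq hα hs] at h

/-- The constant `k(α) > 0` such that the truncated first moment is, up to a constant when
`1 < α`, asymptotic to `± k L ^ (1 - α)`, respectively to `k log L` when `α = 1`. -/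
noncomputable def tailConst (α s : ℝ) : ℝ :=
  if α < 1 then 2 / π * (s * ∫ u in Ioi (0 : ℝ), (1 - cos u) * u ^ (α - 2))
  else if α = 1 then 2 / π * s
  else if α < 2 then 2 / π * (s * (2 - α) * ∫ u in Ioi (0 : ℝ), sin u * u ^ (α - 3))
  -- For `α = 2` the constant multiplies a term that vanishes beside `κ_sat`, so any nonzero value
  -- serves.
  else 1

lemma tailConst_pos (hα0 : 0 < α) (hs : 0 < s) : 0 < tailConst α s := by
  unfold tailConst
  split_ifs with h1 h2 h3
  · have := integral_one_sub_cos_mul_rpow_pos (β := α - 2) (by linarith) (by linarith)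
    positivity
  · positivity
  · have h4 : 1 < α := lt_of_le_of_ne (not_lt.1 h1) (Ne.symm h2)
    have := integral_sin_mul_rpow_pos (β := α - 3) (by linarith) (by linarith)
    have : 0 < 2 - α := by linarith
    positivity
  · exact one_pos

lemma tendsto_integral_min_abs_of_lt_one (hα0 : 0 < α) (hα : α < 1) (hs : 0 < s)
    (hρ : ∀ θ, charFun ρ θ = ((exp (-(s * |θ| ^ α)) : ℝ) : ℂ)) :
    Tendsto (fun L => (∫ y, min |y| L ∂ρ) / L ^ (1 - α)) atTop (𝓝 (tailConst α s)) := by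
  rw [tailConst, if_pos hα]
  refine ((tendsto_rpow_mul_integral_of_lt_one hα0 hα hs).const_mul (2 / π)).congr' ?_
  filter_upwards [eventually_gt_atTop 0] with L hL
  rw [integral_min_abs_of_stable hρ hL.le, show α - 1 = -(1 - α) by ring, rpow_neg hL.le]
  ring

lemma tendsto_integral_min_abs_of_eq_one (hα : α = 1) (hs : 0 < s)
    (hρ : ∀ θ, charFun ρ θ = ((exp (-(s * |θ| ^ α)) : ℝ) : ℂ)) :
    Tendsto (fun L => (∫ y, min |y| L ∂ρ) / log L) atTop (𝓝 (tailConst α s)) := by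
  rw [tailConst, if_neg hα.not_lt, if_pos hα]
  refine ((tendsto_integral_div_log hs).const_mul (2 / π)).congr' ?_
  filter_upwards [eventually_gt_atTop 0] with L hL
  rw [integral_min_abs_of_stable hρ hL.le, hα]
  simp_rw [rpow_one]
  ring

/-- The `1` in `1 - cos (θL)` reproduces the full moment; minus the cosine integral remains, whence
the sign. -/
lemma tendsto_integral_min_abs_of_one_lt (hα1 : 1 < α) (hα2 : α < 2) (hs : 0 < s)
    (hρ : ∀ θ, charFun ρ θ = ((exp (-(s * |θ| ^ α)) : ℝ) : ℂ)) :
    Tendsto (fun L => (∫ y, min |y| L ∂ρ - ∫ y, |y| ∂ρ) / L ^ (1 - α)) atTop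
      (𝓝 (-tailConst α s)) := by
  rw [tailConst, if_neg (by linarith), if_neg hα1.ne', if_pos hα2]
  refine ((tendsto_rpow_mul_integral_cos hα1 hα2 hs).const_mul (2 / π)).neg.congr' ?_
  filter_upwards [eventually_gt_atTop 0] with L hL
  have hi := integrableOn_one_sub_exp_div_sq hα1 hs
  have hi2 : IntegrableOn (fun θ => cos (θ * L) * ((1 - exp (-(s * θ ^ α))) / θ ^ 2)) (Ioi 0) := by
    refine Integrable.mono hi (Measurable.aestronglyMeasurable (by fun_prop))
      (ae_of_all _ fun x => ?_)
    rw [norm_mul]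
    exact mul_le_of_le_one_left (norm_nonneg _) (abs_cos_le_one _)
  rw [integral_min_abs_of_stable hρ hL.le, (integrable_abs_of_stable hα1 hs hρ).2,
    ← integral_one_sub_exp_div_sq hα1 hs, show α - 1 = -(1 - α) by ring, rpow_neg hL.le]
  simp_rw [one_sub_mul]
  rw [integral_sub hi hi2]
  ring

lemma integral_abs_sub_integral_min_abs_le_of_eq_two (hα : α = 2) (hs : 0 < s)
    (hρ : ∀ θ, charFun ρ θ = ((exp (-(s * |θ| ^ α)) : ℝ) : ℂ)) {L : ℝ} (hL : 0 ≤ L) :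
    |∫ y, min |y| L ∂ρ - ∫ y, |y| ∂ρ| ≤ exp (-L ^ 2 / (4 * s)) * (2 * ∫ y, |y| ∂ρ) := by
  -- Matching `exp (-s θ²)` with the Gaussian `exp (-v θ² / 2)`.
  let v : ℝ≥0 := ⟨2 * s, by positivity⟩
  have hvs : (v : ℝ) = 2 * s := rfl
  have hv : v ≠ 0 := by
    rw [← NNReal.coe_ne_zero, hvs]
    positivity
  have hg : ρ = gaussianReal 0 v := by
    refine Measure.ext_of_charFun (funext fun θ => ?_)
    rw [hρ, charFun_gaussianReal, Complex.ofReal_exp, hα, rpow_two, sq_abs]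
    congr 1
    have : ((v : ℝ) : ℂ) = 2 * s := by rw [hvs]; push_cast; ring
    rw [this]
    push_cast
    ring
  have hi := (integrable_abs_of_stable (by linarith) hs hρ).1
  have hm : Integrable (fun y => min |y| L) ρ := by
    refine hi.mono' (Measurable.aestronglyMeasurable (by fun_prop)) (ae_of_all _ fun y => ?_)
    rw [norm_eq_abs, abs_of_nonneg (le_min (abs_nonneg y) hL)]
    exact min_le_left _ _
  have h := integral_abs_sub_min_gaussianReal_le hv hL
  rw [← hg, integral_sub hi hm, hvs, ← mul_assoc (2 : ℝ) 2 s, show (2 : ℝ) * 2 = 4 by norm_num] at h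
  rwa [abs_sub_comm, abs_of_nonneg]
  rw [sub_nonneg]
  exact integral_mono hm hi fun y => min_le_left _ _

end StableLaw

end Analysis

section Count

open Set
open scoped ENNReal

/-! ### Number variance of a conditionally independent family of events -/

/-- Variables `Z j` with law `μ`, pairwise independent and jointly independent of `ε`, in the sense
needed for second moments. -/
structure IsPairwiseSystem {Ω : Type*} [MeasurableSpace Ω] (ε : Ω → ℝ) (Z : ℤ → Ω → ℝ)
    (P : Measure Ω) (U μ : Measure ℝ) : Prop where
  measurable_shift : Measurable ε
  measurable : ∀ j, Measurable (Z j)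
  law_one : ∀ j, P.map (fun ω => (ε ω, Z j ω)) = U.prod μ
  law_two : ∀ i j, i ≠ j → P.map (fun ω => (ε ω, (Z i ω, Z j ω))) = U.prod (μ.prod μ)

/-- The probability of the section at `e` of a planar set. -/
noncomputable def sectionProb (μ : Measure ℝ) (B : Set (ℝ × ℝ)) (e : ℝ) : ℝ≥0∞ :=
  μ (Prod.mk e ⁻¹' B)

/-- The centred indicator of a planar set. -/
noncomputable def centredIndicator (μ : Measure ℝ) (B : Set (ℝ × ℝ)) (z : ℝ × ℝ) : ℝ :=
  B.indicator (fun _ => (1 : ℝ)) z - (sectionProb μ B z.1).toReal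

section Section

variable {μ : Measure ℝ} [IsProbabilityMeasure μ] {B : Set (ℝ × ℝ)}

lemma measurable_sectionProb (hB : MeasurableSet B) : Measurable (sectionProb μ B) :=
  measurable_measure_prodMk_left hB

lemma sectionProb_toReal_le_one (e : ℝ) : (sectionProb μ B e).toReal ≤ 1 :=
  ENNReal.toReal_mono ENNReal.one_ne_top prob_le_one

lemma measurable_centredIndicator (hB : MeasurableSet B) :
    Measurable (centredIndicator μ B) :=
  (measurable_const.indicator hB).sub
    ((measurable_sectionProb hB).ennreal_toReal.comp measurable_fst)

lemma abs_centredIndicator_le_one (z : ℝ × ℝ) : |centredIndicator μ B z| ≤ 1 := by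
  have h1 := sectionProb_toReal_le_one (μ := μ) (B := B) z.1
  have h2 : 0 ≤ (sectionProb μ B z.1).toReal := ENNReal.toReal_nonneg
  rw [centredIndicator, abs_le]
  by_cases hz : z ∈ B
  · rw [indicator_of_mem hz]; constructor <;> linarith
  · rw [indicator_of_notMem hz]; constructor <;> linarith

lemma integral_section_indicator (hB : MeasurableSet B) (e : ℝ) :
    Integrable (fun x => B.indicator (fun _ => (1 : ℝ)) (e, x)) μ ∧
    ∫ x, B.indicator (fun _ => (1 : ℝ)) (e, x) ∂μ = (sectionProb μ B e).toReal := by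
  have h : (fun x => B.indicator (fun _ => (1 : ℝ)) (e, x)) =
      (Prod.mk e ⁻¹' B).indicator (fun _ => (1 : ℝ)) := rfl
  have hm : MeasurableSet (Prod.mk e ⁻¹' B) := measurable_prodMk_left hB
  rw [h]
  refine ⟨(integrable_const _).indicator hm, ?_⟩
  rw [integral_indicator_const _ hm, smul_eq_mul, mul_one]
  rfl

lemma integral_centredIndicator (hB : MeasurableSet B) (e : ℝ) :
    ∫ x, centredIndicator μ B (e, x) ∂μ = 0 := by
  obtain ⟨hi, he⟩ := integral_section_indicator (μ := μ) hB e
  simp only [centredIndicator]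
  rw [integral_sub hi (integrable_const _), he]
  simp

lemma integral_centredIndicator_sq (hB : MeasurableSet B) (e : ℝ) :
    ∫ x, centredIndicator μ B (e, x) ^ 2 ∂μ =
      (sectionProb μ B e).toReal * (1 - (sectionProb μ B e).toReal) := by
  obtain ⟨hi, he⟩ := integral_section_indicator (μ := μ) hB e
  have h : ∀ x, centredIndicator μ B (e, x) ^ 2 =
      (1 - 2 * (sectionProb μ B e).toReal) * B.indicator (fun _ => (1 : ℝ)) (e, x) +
        (sectionProb μ B e).toReal ^ 2 := by
    intro x
    simp only [centredIndicator]
    by_cases hz : (e, x) ∈ B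
    · rw [indicator_of_mem hz]; ring
    · rw [indicator_of_notMem hz]; ring
  simp_rw [h]
  rw [integral_add (hi.const_mul _) (integrable_const _), integral_const_mul, he]
  simp
  ring

end Section

set_option linter.unusedSectionVars false

/-! ### Second moments of the number of events, given the shift. -/

section PairwiseSystem

variable {Ω : Type*} [MeasurableSpace Ω] {P : Measure Ω} [IsProbabilityMeasure P]
  {U μ : Measure ℝ} [IsProbabilityMeasure U] [IsProbabilityMeasure μ]
  {ε : Ω → ℝ} {Z : ℤ → Ω → ℝ} {B : ℤ → Set (ℝ × ℝ)} {M : ℝ≥0∞}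

lemma IsPairwiseSystem.measurableSet_event (h : IsPairwiseSystem ε Z P U μ)
    (hB : ∀ j, MeasurableSet (B j)) (j : ℤ) : MeasurableSet {ω | (ε ω, Z j ω) ∈ B j} :=
  (h.measurable_shift.prodMk (h.measurable j)) (hB j)

lemma IsPairwiseSystem.measure_event (h : IsPairwiseSystem ε Z P U μ)
    (hB : ∀ j, MeasurableSet (B j)) (j : ℤ) :
    P {ω | (ε ω, Z j ω) ∈ B j} = ∫⁻ e, sectionProb μ (B j) e ∂U := by
  have h1 := Measure.map_apply (μ := P) (h.measurable_shift.prodMk (h.measurable j)) (hB j)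
  rw [h.law_one, Measure.prod_apply (hB j)] at h1
  exact h1.symm

lemma IsPairwiseSystem.measure_event_inter (h : IsPairwiseSystem ε Z P U μ)
    (hB : ∀ j, MeasurableSet (B j)) {i j : ℤ} (hij : i ≠ j) :
    P ({ω | (ε ω, Z i ω) ∈ B i} ∩ {ω | (ε ω, Z j ω) ∈ B j}) =
      ∫⁻ e, sectionProb μ (B i) e * sectionProb μ (B j) e ∂U := by
  have hS : MeasurableSet {z : ℝ × ℝ × ℝ | (z.1, z.2.1) ∈ B i ∧ (z.1, z.2.2) ∈ B j} :=
    (measurable_fst.prodMk measurable_snd.fst (hB i)).inter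
      (measurable_fst.prodMk measurable_snd.snd (hB j))
  have h1 := Measure.map_apply (μ := P)
    (h.measurable_shift.prodMk ((h.measurable i).prodMk (h.measurable j))) hS
  rw [h.law_two i j hij, Measure.prod_apply hS] at h1
  refine h1.symm.trans (lintegral_congr fun e => ?_)
  have : Prod.mk e ⁻¹' {z : ℝ × ℝ × ℝ | (z.1, z.2.1) ∈ B i ∧ (z.1, z.2.2) ∈ B j} =
      (Prod.mk e ⁻¹' B i) ×ˢ (Prod.mk e ⁻¹' B j) := rfl
  rw [this, Measure.prod_prod]
  rfl

lemma IsPairwiseSystem.tsum_measure_event_le (h : IsPairwiseSystem ε Z P U μ)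
    (hB : ∀ j, MeasurableSet (B j)) (hM : ∀ e, ∑' j, sectionProb μ (B j) e ≤ M) :
    ∑' j, P {ω | (ε ω, Z j ω) ∈ B j} ≤ M := by
  simp_rw [h.measure_event hB]
  rw [← lintegral_tsum fun j => (measurable_sectionProb (hB j)).aemeasurable]
  refine (lintegral_mono hM).trans ?_
  simp

/-- Borel–Cantelli: the event probabilities have a finite sum. -/
lemma IsPairwiseSystem.ae_finite (h : IsPairwiseSystem ε Z P U μ)
    (hB : ∀ j, MeasurableSet (B j)) (hM : ∀ e, ∑' j, sectionProb μ (B j) e ≤ M) (hM' : M ≠ ∞) :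
    ∀ᵐ ω ∂P, {j | (ε ω, Z j ω) ∈ B j}.Finite :=
  ae_finite_setOfPred_mem (ne_top_of_le_ne_top hM' (h.tsum_measure_event_le hB hM))

/-- The number of events that occur. -/
noncomputable def eventCount (ε : Ω → ℝ) (Z : ℤ → Ω → ℝ) (B : ℤ → Set (ℝ × ℝ)) (ω : Ω) : ℝ :=
  ∑' j, (B j).indicator (fun _ => (1 : ℝ)) (ε ω, Z j ω)

/-- Expand the square as a double sum. The diagonal is the expected count, at most `M`; off the
diagonal, conditional independence gives products, whose full double sum is the mean of a square
bounded by `M²`. -/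
lemma IsPairwiseSystem.lintegral_sq_le (h : IsPairwiseSystem ε Z P U μ)
    (hB : ∀ j, MeasurableSet (B j)) (hM : ∀ e, ∑' j, sectionProb μ (B j) e ≤ M) :
    ∫⁻ ω, (∑' j, (B j).indicator (fun _ => (1 : ℝ≥0∞)) (ε ω, Z j ω)) ^ 2 ∂P ≤ M + M ^ 2 := by
  have hm : ∀ j, Measurable fun ω => (B j).indicator (fun _ => (1 : ℝ≥0∞)) (ε ω, Z j ω) :=
    fun j => (measurable_const.indicator (hB j)).comp
      (h.measurable_shift.prodMk (h.measurable j))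
  have hterm : ∀ i j, ∫⁻ ω, (B i).indicator (fun _ => (1 : ℝ≥0∞)) (ε ω, Z i ω) *
      (B j).indicator (fun _ => (1 : ℝ≥0∞)) (ε ω, Z j ω) ∂P ≤
      (if j = i then P {ω | (ε ω, Z i ω) ∈ B i} else 0) +
        ∫⁻ e, sectionProb μ (B i) e * sectionProb μ (B j) e ∂U := by
    intro i j
    have hi : ∀ ω, (B i).indicator (fun _ => (1 : ℝ≥0∞)) (ε ω, Z i ω) *
      (B j).indicator (fun _ => (1 : ℝ≥0∞)) (ε ω, Z j ω) =
        ({ω | (ε ω, Z i ω) ∈ B i} ∩ {ω | (ε ω, Z j ω) ∈ B j}).indicator 1 ω := by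
      intro ω
      by_cases h1 : (ε ω, Z i ω) ∈ B i <;> by_cases h2 : (ε ω, Z j ω) ∈ B j <;>
        simp [indicator, h1, h2]
    simp_rw [hi]
    rw [lintegral_indicator_one ((h.measurableSet_event hB i).inter (h.measurableSet_event hB j))]
    by_cases hij : j = i
    · subst hij
      simp
    · rw [h.measure_event_inter hB (Ne.symm hij)]
      exact le_add_self
  calc ∫⁻ ω, (∑' j, (B j).indicator (fun _ => (1 : ℝ≥0∞)) (ε ω, Z j ω)) ^ 2 ∂P
      = ∑' i, ∑' j, ∫⁻ ω, (B i).indicator (fun _ => (1 : ℝ≥0∞)) (ε ω, Z i ω) *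
          (B j).indicator (fun _ => (1 : ℝ≥0∞)) (ε ω, Z j ω) ∂P := by
        simp_rw [sq, ← ENNReal.tsum_mul_right, ← ENNReal.tsum_mul_left]
        rw [lintegral_tsum fun i => by fun_prop]
        congr 1 with i
        rw [lintegral_tsum fun j => by fun_prop]
    _ ≤ ∑' i, ∑' j, ((if j = i then P {ω | (ε ω, Z i ω) ∈ B i} else 0) +
        ∫⁻ e, sectionProb μ (B i) e * sectionProb μ (B j) e ∂U) :=
        ENNReal.tsum_le_tsum fun i => ENNReal.tsum_le_tsum fun j => hterm i j
    _ = ∑' i, P {ω | (ε ω, Z i ω) ∈ B i} +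
        ∫⁻ e, (∑' j, sectionProb μ (B j) e) ^ 2 ∂U := by
        have hs : ∀ j, Measurable (sectionProb μ (B j)) := fun j => measurable_sectionProb (hB j)
        simp_rw [ENNReal.tsum_add, tsum_ite_eq, sq, ← ENNReal.tsum_mul_right,
          ← ENNReal.tsum_mul_left]
        congr 1
        rw [lintegral_tsum fun i => by fun_prop]
        congr 1 with i
        rw [lintegral_tsum fun j => by fun_prop]
    _ ≤ M + M ^ 2 := by
        refine add_le_add (h.tsum_measure_event_le hB hM) ?_
        calc ∫⁻ e, (∑' j, sectionProb μ (B j) e) ^ 2 ∂U ≤ ∫⁻ _, M ^ 2 ∂U :=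
              lintegral_mono fun e => by gcongr; exact hM e
          _ = M ^ 2 := by simp

/-- Valid for every `ω`: when infinitely many events occur, both the real `tsum` and `toReal ∞` are
`0`. -/
lemma eventCount_eq_toReal (ω : Ω) : eventCount ε Z B ω =
    (∑' j, (B j).indicator (fun _ => (1 : ℝ≥0∞)) (ε ω, Z j ω)).toReal := by
  rw [ENNReal.tsum_toReal_eq fun j => by
    by_cases h1 : (ε ω, Z j ω) ∈ B j <;> simp [indicator, h1], eventCount]
  congr 1 with j
  by_cases h1 : (ε ω, Z j ω) ∈ B j <;> simp [indicator, h1]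

lemma IsPairwiseSystem.memLp_eventCount (h : IsPairwiseSystem ε Z P U μ)
    (hB : ∀ j, MeasurableSet (B j)) (hM : ∀ e, ∑' j, sectionProb μ (B j) e ≤ M) (hM' : M ≠ ∞) :
    MemLp (eventCount ε Z B) 2 P := by
  have hm : ∀ j, Measurable fun ω => (B j).indicator (fun _ => (1 : ℝ≥0∞)) (ε ω, Z j ω) :=
    fun j => (measurable_const.indicator (hB j)).comp
      (h.measurable_shift.prodMk (h.measurable j))
  have hN : Measurable (eventCount ε Z B) := by
    have : eventCount ε Z B = fun ω =>
        (∑' j, (B j).indicator (fun _ => (1 : ℝ≥0∞)) (ε ω, Z j ω)).toReal :=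
      funext eventCount_eq_toReal
    rw [this]
    exact (Measurable.tsum hm).ennreal_toReal
  rw [memLp_two_iff_integrable_sq hN.aestronglyMeasurable]
  refine ⟨(hN.pow_const 2).aestronglyMeasurable, ?_⟩
  rw [hasFiniteIntegral_iff_ofReal (ae_of_all _ fun ω => sq_nonneg _)]
  refine lt_of_le_of_lt (lintegral_mono fun ω => ?_)
    ((h.lintegral_sq_le hB hM).trans_lt (ENNReal.add_lt_top.2
      ⟨hM'.lt_top, ENNReal.pow_lt_top hM'.lt_top⟩))
  rw [eventCount_eq_toReal, ← ENNReal.toReal_pow]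
  exact ENNReal.ofReal_toReal_le

/-- The conditional mean of the number of events given the shift. -/
noncomputable def meanCount (μ : Measure ℝ) (B : ℤ → Set (ℝ × ℝ)) (e : ℝ) : ℝ :=
  ∑' j, (sectionProb μ (B j) e).toReal

lemma hasSum_meanCount (hM : ∀ e, ∑' j, sectionProb μ (B j) e ≤ M) (hM' : M ≠ ∞) (e : ℝ) :
    HasSum (fun j => (sectionProb μ (B j) e).toReal) (meanCount μ B e) :=
  (ENNReal.summable_toReal (ne_top_of_le_ne_top hM' (hM e))).hasSum

lemma meanCount_eq_toReal (e : ℝ) :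
    meanCount μ B e = (∑' j, sectionProb μ (B j) e).toReal :=
  (ENNReal.tsum_toReal_eq fun _ => measure_ne_top _ _).symm

lemma measurable_meanCount (hB : ∀ j, MeasurableSet (B j)) : Measurable (meanCount μ B) := by
  rw [show meanCount μ B = fun e => (∑' j, sectionProb μ (B j) e).toReal from
    funext meanCount_eq_toReal]
  exact (Measurable.tsum fun j => measurable_sectionProb (hB j)).ennreal_toReal

lemma IsPairwiseSystem.memLp_meanCount (h : IsPairwiseSystem ε Z P U μ)
    (hB : ∀ j, MeasurableSet (B j)) (hM : ∀ e, ∑' j, sectionProb μ (B j) e ≤ M) (hM' : M ≠ ∞) :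
    MemLp (fun ω => meanCount μ B (ε ω)) 2 P := by
  refine MemLp.of_bound ((measurable_meanCount hB).comp
    h.measurable_shift).aestronglyMeasurable M.toReal (ae_of_all _ fun ω => ?_)
  rw [meanCount_eq_toReal, Real.norm_eq_abs, abs_of_nonneg ENNReal.toReal_nonneg]
  exact ENNReal.toReal_mono hM' (hM _)

lemma IsPairwiseSystem.measurable_centred (h : IsPairwiseSystem ε Z P U μ)
    (hB : ∀ j, MeasurableSet (B j)) (j : ℤ) :
    Measurable fun ω => centredIndicator μ (B j) (ε ω, Z j ω) :=
  (measurable_centredIndicator (hB j)).comp (h.measurable_shift.prodMk (h.measurable j))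

/-- Orthogonality: for a fixed shift the two factors are independent and centred. -/
lemma IsPairwiseSystem.integral_centred_mul (h : IsPairwiseSystem ε Z P U μ)
    (hB : ∀ j, MeasurableSet (B j)) {i j : ℤ} (hij : i ≠ j) :
    ∫ ω, centredIndicator μ (B i) (ε ω, Z i ω) * centredIndicator μ (B j) (ε ω, Z j ω) ∂P = 0 := by
  let f : ℝ × ℝ × ℝ → ℝ := fun z =>
    centredIndicator μ (B i) (z.1, z.2.1) * centredIndicator μ (B j) (z.1, z.2.2)
  have hf : Measurable f :=
    ((measurable_centredIndicator (hB i)).comp (measurable_fst.prodMk measurable_snd.fst)).mul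
      ((measurable_centredIndicator (hB j)).comp (measurable_fst.prodMk measurable_snd.snd))
  have hm : Measurable fun ω => (ε ω, (Z i ω, Z j ω)) :=
    h.measurable_shift.prodMk ((h.measurable i).prodMk (h.measurable j))
  have h1 := integral_map (μ := P) hm.aemeasurable hf.aestronglyMeasurable
  rw [h.law_two i j hij, integral_prod] at h1
  · refine h1.symm.trans ?_
    refine integral_eq_zero_of_ae (ae_of_all _ fun e => ?_)
    change ∫ z : ℝ × ℝ, centredIndicator μ (B i) (e, z.1) * centredIndicator μ (B j) (e, z.2)
      ∂(μ.prod μ) = 0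
    rw [integral_prod_mul (fun x => centredIndicator μ (B i) (e, x))
      (fun y => centredIndicator μ (B j) (e, y)), integral_centredIndicator (hB i), zero_mul]
  · refine (integrable_const (1 : ℝ)).mono' hf.aestronglyMeasurable (ae_of_all _ fun z => ?_)
    rw [Real.norm_eq_abs, abs_mul]
    exact mul_le_one₀ (abs_centredIndicator_le_one _) (abs_nonneg _)
      (abs_centredIndicator_le_one _)

lemma IsPairwiseSystem.integral_centred_sq (h : IsPairwiseSystem ε Z P U μ)
    (hB : ∀ j, MeasurableSet (B j)) (j : ℤ) :
    ∫ ω, centredIndicator μ (B j) (ε ω, Z j ω) ^ 2 ∂P =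
      ∫ e, (sectionProb μ (B j) e).toReal * (1 - (sectionProb μ (B j) e).toReal) ∂U := by
  have hf := (measurable_centredIndicator (μ := μ) (hB j)).pow_const 2
  have hm : Measurable fun ω => (ε ω, Z j ω) := h.measurable_shift.prodMk (h.measurable j)
  have h1 := integral_map (μ := P) hm.aemeasurable hf.aestronglyMeasurable
  rw [h.law_one, integral_prod] at h1
  · refine h1.symm.trans ?_
    simp_rw [integral_centredIndicator_sq (hB j)]
  · refine (integrable_const (1 : ℝ)).mono' hf.aestronglyMeasurable (ae_of_all _ fun z => ?_)
    rw [Real.norm_eq_abs, abs_pow]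
    exact pow_le_one₀ (abs_nonneg _) (abs_centredIndicator_le_one _)

lemma IsPairwiseSystem.setIntegral_centred (h : IsPairwiseSystem ε Z P U μ)
    (hB : ∀ j, MeasurableSet (B j)) (j : ℤ) {S : Set ℝ} (hS : MeasurableSet S) :
    ∫ ω in ε ⁻¹' S, centredIndicator μ (B j) (ε ω, Z j ω) ∂P = 0 := by
  let f : ℝ × ℝ → ℝ := fun z => S.indicator (fun _ => (1 : ℝ)) z.1 * centredIndicator μ (B j) z
  have hf : Measurable f := ((measurable_const.indicator hS).comp measurable_fst).mul
    (measurable_centredIndicator (hB j))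
  have hm : Measurable fun ω => (ε ω, Z j ω) := h.measurable_shift.prodMk (h.measurable j)
  have h1 := integral_map (μ := P) hm.aemeasurable hf.aestronglyMeasurable
  rw [h.law_one, integral_prod] at h1
  · rw [← integral_indicator (h.measurable_shift hS)]
    have heq : ∀ ω, (ε ⁻¹' S).indicator (fun ω => centredIndicator μ (B j) (ε ω, Z j ω)) ω =
        f (ε ω, Z j ω) := by
      intro ω
      by_cases hω : ε ω ∈ S <;> simp [f, indicator, hω]
    simp_rw [heq]
    refine h1.symm.trans (integral_eq_zero_of_ae (ae_of_all _ fun e => ?_))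
    change ∫ y, S.indicator (fun _ => (1 : ℝ)) e * centredIndicator μ (B j) (e, y) ∂μ = 0
    rw [integral_const_mul, integral_centredIndicator (hB j), mul_zero]
  · refine (integrable_const (1 : ℝ)).mono' hf.aestronglyMeasurable (ae_of_all _ fun z => ?_)
    rw [Real.norm_eq_abs, abs_mul]
    refine mul_le_one₀ ?_ (abs_nonneg _) (abs_centredIndicator_le_one _)
    by_cases hz : z.1 ∈ S <;> simp [indicator, hz]

lemma IsPairwiseSystem.ae_hasSum_centred (h : IsPairwiseSystem ε Z P U μ)
    (hB : ∀ j, MeasurableSet (B j)) (hM : ∀ e, ∑' j, sectionProb μ (B j) e ≤ M) (hM' : M ≠ ∞) :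
    ∀ᵐ ω ∂P, HasSum (fun j => (B j).indicator (fun _ => (1 : ℝ)) (ε ω, Z j ω))
      (eventCount ε Z B ω) := by
  filter_upwards [h.ae_finite hB hM hM'] with ω hω
  refine (summable_of_hasFiniteSupport (hω.subset fun j hj => ?_)).hasSum
  by_contra hn
  exact hj (indicator_of_notMem (s := B j) hn _)

/-- The dominating function, square-integrable and independent of `F`, that lets limits over finite
sets pass through expectations. -/
lemma IsPairwiseSystem.ae_abs_sum_centred_le (h : IsPairwiseSystem ε Z P U μ)
    (hB : ∀ j, MeasurableSet (B j)) (hM : ∀ e, ∑' j, sectionProb μ (B j) e ≤ M) (hM' : M ≠ ∞) :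
    ∀ᵐ ω ∂P, ∀ F : Finset ℤ, |∑ j ∈ F, centredIndicator μ (B j) (ε ω, Z j ω)| ≤
      eventCount ε Z B ω + meanCount μ B (ε ω) := by
  filter_upwards [h.ae_hasSum_centred hB hM hM'] with ω hω F
  simp only [centredIndicator, Finset.sum_sub_distrib]
  have h1 : ∑ j ∈ F, (B j).indicator (fun _ => (1 : ℝ)) (ε ω, Z j ω) ≤ eventCount ε Z B ω :=
    sum_le_hasSum F (fun j _ => indicator_nonneg (fun _ _ => zero_le_one) _) hω
  have h2 : ∑ j ∈ F, (sectionProb μ (B j) (ε ω)).toReal ≤ meanCount μ B (ε ω) :=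
    sum_le_hasSum F (fun j _ => ENNReal.toReal_nonneg) (hasSum_meanCount hM hM' _)
  have h3 : 0 ≤ ∑ j ∈ F, (B j).indicator (fun _ => (1 : ℝ)) (ε ω, Z j ω) :=
    Finset.sum_nonneg fun j _ => indicator_nonneg (fun _ _ => zero_le_one) _
  have h4 : 0 ≤ ∑ j ∈ F, (sectionProb μ (B j) (ε ω)).toReal :=
    Finset.sum_nonneg fun j _ => ENNReal.toReal_nonneg
  rw [abs_le]
  constructor <;> linarith

lemma IsPairwiseSystem.ae_tendsto_sum_centred (h : IsPairwiseSystem ε Z P U μ)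
    (hB : ∀ j, MeasurableSet (B j)) (hM : ∀ e, ∑' j, sectionProb μ (B j) e ≤ M) (hM' : M ≠ ∞) :
    ∀ᵐ ω ∂P, Tendsto (fun F : Finset ℤ => ∑ j ∈ F, centredIndicator μ (B j) (ε ω, Z j ω)) atTop
      (𝓝 (eventCount ε Z B ω - meanCount μ B (ε ω))) := by
  filter_upwards [h.ae_hasSum_centred hB hM hM'] with ω hω
  exact hω.sub (hasSum_meanCount hM hM' (ε ω))

/-- Finite centred sums integrate to zero over every event determined by the shift; dominated
convergence carries this to the full count. -/
lemma IsPairwiseSystem.condExp_eventCount (h : IsPairwiseSystem ε Z P U μ)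
    (hB : ∀ j, MeasurableSet (B j)) (hM : ∀ e, ∑' j, sectionProb μ (B j) e ≤ M) (hM' : M ≠ ∞) :
    P[eventCount ε Z B | MeasurableSpace.comap ε inferInstance] =ᵐ[P]
      fun ω => meanCount μ B (ε ω) := by
  have hN := (h.memLp_eventCount hB hM hM').integrable one_le_two
  have hg := (h.memLp_meanCount hB hM hM').integrable one_le_two
  refine (ae_eq_condExp_of_forall_setIntegral_eq h.measurable_shift.comap_le hN
    (fun _ _ _ => hg.integrableOn) ?_ ?_).symm
  · rintro _ ⟨S, hS, rfl⟩ -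
    have hlim : Tendsto (fun F : Finset ℤ => ∫ ω in ε ⁻¹' S,
        ∑ j ∈ F, centredIndicator μ (B j) (ε ω, Z j ω) ∂P) atTop
        (𝓝 (∫ ω in ε ⁻¹' S, (eventCount ε Z B ω - meanCount μ B (ε ω)) ∂P)) := by
      refine tendsto_integral_filter_of_dominated_convergence
        (fun ω => eventCount ε Z B ω + meanCount μ B (ε ω)) ?_ ?_ (hN.add hg).integrableOn ?_
      · exact Eventually.of_forall fun F => (Finset.measurable_sum F fun j _ =>
          h.measurable_centred hB j).aestronglyMeasurable
      · refine Eventually.of_forall fun F => ae_restrict_of_ae ?_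
        filter_upwards [h.ae_abs_sum_centred_le hB hM hM'] with ω hω using hω F
      · exact ae_restrict_of_ae (h.ae_tendsto_sum_centred hB hM hM')
    have hz : ∀ F : Finset ℤ, ∫ ω in ε ⁻¹' S,
        ∑ j ∈ F, centredIndicator μ (B j) (ε ω, Z j ω) ∂P = 0 := by
      intro F
      rw [integral_finsetSum]
      · exact Finset.sum_eq_zero fun j _ => h.setIntegral_centred hB j hS
      · intro j _
        exact ((integrable_const (1 : ℝ)).mono' (h.measurable_centred hB j).aestronglyMeasurable
          (ae_of_all _ fun ω => abs_centredIndicator_le_one _)).integrableOn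
    simp_rw [hz] at hlim
    have := tendsto_nhds_unique hlim tendsto_const_nhds
    rw [integral_sub hN.integrableOn hg.integrableOn] at this
    linarith
  · exact ((measurable_meanCount hB).comp (comap_measurable ε)).aestronglyMeasurable

/-- The averaged conditional variance is the squared `L²` distance from the count to its conditional
mean. Squares of finite centred sums converge to it in mean; orthogonality leaves only the diagonal,
so this limit over finite sets is the asserted `HasSum`. -/
lemma IsPairwiseSystem.hasSum_integral_condVar (h : IsPairwiseSystem ε Z P U μ)
    (hB : ∀ j, MeasurableSet (B j)) (hM : ∀ e, ∑' j, sectionProb μ (B j) e ≤ M) (hM' : M ≠ ∞) :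
    HasSum (fun j => ∫ e, (sectionProb μ (B j) e).toReal *
        (1 - (sectionProb μ (B j) e).toReal) ∂U)
      (∫ ω, condVar (MeasurableSpace.comap ε inferInstance) (eventCount ε Z B) P ω ∂P) := by
  have hN := h.memLp_eventCount hB hM hM'
  have hg := h.memLp_meanCount hB hM hM'
  have hV : ∫ ω, condVar (MeasurableSpace.comap ε inferInstance) (eventCount ε Z B) P ω ∂P =
      ∫ ω, (eventCount ε Z B ω - meanCount μ B (ε ω)) ^ 2 ∂P := by
    rw [condVar, integral_condExp h.measurable_shift.comap_le]
    refine integral_congr_ae ?_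
    filter_upwards [h.condExp_eventCount hB hM hM'] with ω hω
    simp [hω]
  rw [hV]
  have hlim : Tendsto (fun F : Finset ℤ => ∫ ω,
      (∑ j ∈ F, centredIndicator μ (B j) (ε ω, Z j ω)) ^ 2 ∂P) atTop
      (𝓝 (∫ ω, (eventCount ε Z B ω - meanCount μ B (ε ω)) ^ 2 ∂P)) := by
    refine tendsto_integral_filter_of_dominated_convergence
      (fun ω => (eventCount ε Z B ω + meanCount μ B (ε ω)) ^ 2) ?_ ?_ (hN.add hg).integrable_sq ?_
    · exact Eventually.of_forall fun F => ((Finset.measurable_sum F fun j _ =>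
        h.measurable_centred hB j).pow_const 2).aestronglyMeasurable
    · refine Eventually.of_forall fun F => ?_
      filter_upwards [h.ae_abs_sum_centred_le hB hM hM'] with ω hω
      rw [Real.norm_eq_abs, abs_pow]
      gcongr
      exact hω F
    · filter_upwards [h.ae_tendsto_sum_centred hB hM hM'] with ω hω using hω.pow 2
  have hint : ∀ i j, Integrable (fun ω => centredIndicator μ (B i) (ε ω, Z i ω) *
      centredIndicator μ (B j) (ε ω, Z j ω)) P := fun i j =>
    (integrable_const (1 : ℝ)).mono'
      ((h.measurable_centred hB i).mul (h.measurable_centred hB j)).aestronglyMeasurable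
      (ae_of_all _ fun ω => by
        rw [Real.norm_eq_abs, abs_mul]
        exact mul_le_one₀ (abs_centredIndicator_le_one _) (abs_nonneg _)
          (abs_centredIndicator_le_one _))
  refine Tendsto.congr (fun F => ?_) hlim
  simp_rw [sq, Finset.sum_mul_sum]
  rw [integral_finsetSum _ fun i _ => integrable_finsetSum _ fun j _ => hint i j]
  refine Finset.sum_congr rfl fun i hi => ?_
  rw [integral_finsetSum _ fun j _ => hint i j, Finset.sum_eq_single i]
  · simp_rw [← sq]
    exact h.integral_centred_sq hB i
  · exact fun j _ hj => h.integral_centred_mul hB hj.symm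
  · exact fun hn => absurd hi hn

end PairwiseSystem

/-! ### Particles started from a shifted lattice -/

/-- The event that a particle started from `a (j - e)` and displaced by `x` lies in `[0, L]`. -/
def hitSet (a L : ℝ) (j : ℤ) : Set (ℝ × ℝ) :=
  {z | z.2 + a * (j - z.1) ∈ Icc 0 L}

lemma measurableSet_hitSet (a L : ℝ) (j : ℤ) : MeasurableSet (hitSet a L j) := by
  have : Measurable fun z : ℝ × ℝ => z.2 + a * (j - z.1) := by fun_prop
  exact this measurableSet_Icc

/-- An interval of length `L / a` contains at most `L / a + 1` integers. The bound is uniform in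
shift and displacement, so no tail assumption on the law is needed; `|L|` also covers negative `L`.
-/
lemma tsum_indicator_hitSet_le {a : ℝ} (ha : 0 < a) (L e x : ℝ) :
    ∑' j, (hitSet a L j).indicator (fun _ => (1 : ℝ≥0∞)) (e, x) ≤
      ENNReal.ofReal (|L| / a + 1) := by
  let F : Finset ℤ := Finset.Icc ⌈e - x / a⌉ ⌊e - x / a + L / a⌋
  have hF : ∀ j ∉ F, (hitSet a L j).indicator (fun _ => (1 : ℝ≥0∞)) (e, x) = 0 := by
    intro j hj
    refine indicator_of_notMem (fun hmem => hj ?_) _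
    obtain ⟨h1, h2⟩ : 0 ≤ x + a * (j - e) ∧ x + a * (j - e) ≤ L := hmem
    have e1 : x = a * (x / a) := by field_simp
    have e2 : L = a * (L / a) := by field_simp
    rw [Finset.mem_Icc, Int.ceil_le, Int.le_floor]
    constructor
    · rw [e1, ← mul_add] at h1
      have := nonneg_of_mul_nonneg_right h1 ha
      linarith
    · rw [e1, e2, ← mul_add] at h2
      have := le_of_mul_le_mul_left h2 ha
      linarith
  rw [tsum_eq_sum hF]
  calc ∑ j ∈ F, (hitSet a L j).indicator (fun _ => (1 : ℝ≥0∞)) (e, x)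
      ≤ ∑ j ∈ F, 1 := Finset.sum_le_sum fun j _ =>
        indicator_le_self' (fun _ _ => zero_le) _
    _ = ENNReal.ofReal (F.card : ℝ) := by simp
    _ ≤ _ := by
      refine ENNReal.ofReal_le_ofReal ?_
      have hpos : 0 ≤ |L| / a := by positivity
      have hle : L / a ≤ |L| / a := by gcongr; exact le_abs_self L
      rw [Int.card_Icc]
      have h1 := Int.le_ceil (e - x / a)
      have h2 := Int.floor_le (e - x / a + L / a)
      rcases le_total 0 (⌊e - x / a + L / a⌋ + 1 - ⌈e - x / a⌉) with h | h
      · have : (((⌊e - x / a + L / a⌋ + 1 - ⌈e - x / a⌉).toNat : ℤ) : ℝ) =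
            ((⌊e - x / a + L / a⌋ + 1 - ⌈e - x / a⌉ : ℤ) : ℝ) := by rw [Int.toNat_of_nonneg h]
        rw [Int.cast_natCast] at this
        rw [this]
        push_cast
        linarith
      · rw [Int.toNat_of_nonpos h]
        push_cast
        linarith

/-! ### Unfolding the shifted lattice and the law of the difference. -/

section Law

variable {μ : Measure ℝ} [IsProbabilityMeasure μ]

lemma tsum_sectionProb_hitSet_le {a : ℝ} (ha : 0 < a) (L e : ℝ) :
    ∑' j, sectionProb μ (hitSet a L j) e ≤ ENNReal.ofReal (|L| / a + 1) := by
  have hm : ∀ j, MeasurableSet (Prod.mk e ⁻¹' hitSet a L j) := fun j =>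
    measurable_prodMk_left (measurableSet_hitSet a L j)
  have h : ∀ j, sectionProb μ (hitSet a L j) e =
      ∫⁻ x, (hitSet a L j).indicator (fun _ => (1 : ℝ≥0∞)) (e, x) ∂μ := fun j =>
    (lintegral_indicator_one (hm j)).symm
  simp_rw [h]
  rw [← lintegral_tsum fun j => by exact (measurable_const.indicator (hm j)).aemeasurable]
  refine (lintegral_mono fun x => tsum_indicator_hitSet_le ha L e x).trans ?_
  simp

/-- Two intervals of length `L` offset by `|u - v|`. For `L < 0` the set is empty and
`ENNReal.ofReal` truncates to `0`. -/
lemma volume_Icc_diff_Icc (L u v : ℝ) :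
    volume {x : ℝ | u + x ∈ Icc 0 L ∧ v + x ∉ Icc 0 L} = ENNReal.ofReal (min |u - v| L) := by
  have h : {x : ℝ | u + x ∈ Icc 0 L ∧ v + x ∉ Icc 0 L} =
      Icc (-u) (L - u) \ (Icc (-u) (L - u) ∩ Icc (-v) (L - v)) := by
    ext x
    simp only [mem_ofPred_eq, mem_Icc, Set.mem_sdiff, mem_inter_iff]
    constructor
    · rintro ⟨⟨h1, h2⟩, h3⟩
      exact ⟨⟨by linarith, by linarith⟩, fun h4 => h3 ⟨by linarith [h4.2.1], by linarith [h4.2.2]⟩⟩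
    · rintro ⟨⟨h1, h2⟩, h3⟩
      exact ⟨⟨by linarith, by linarith⟩,
        fun h4 => h3 ⟨⟨h1, h2⟩, by linarith [h4.1], by linarith [h4.2]⟩⟩
  rw [h, measure_sdiff inter_subset_left
    (measurableSet_Icc.inter measurableSet_Icc).nullMeasurableSet
    (ne_top_of_le_ne_top (by simp) (measure_mono inter_subset_left)), Icc_inter_Icc,
    Real.volume_Icc, Real.volume_Icc]
  rcases le_total u v with huv | huv
  · rw [sup_of_le_left (by linarith), inf_of_le_right (by linarith),
      abs_of_nonpos (by linarith)]
    rcases le_total (v - u) L with h' | h'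
    · rw [← ENNReal.ofReal_sub _ (by linarith), min_eq_left (by linarith)]
      congr 1
      ring
    · rw [ENNReal.ofReal_of_nonpos (p := L - v - -u) (by linarith), min_eq_right (by linarith),
        tsub_zero]
      congr 1
      ring
  · rw [sup_of_le_right (by linarith), inf_of_le_left (by linarith),
      abs_of_nonneg (by linarith)]
    rcases le_total (u - v) L with h' | h'
    · rw [← ENNReal.ofReal_sub _ (by linarith), min_eq_left (by linarith)]
      congr 1
      ring
    · rw [ENNReal.ofReal_of_nonpos (p := L - u - -v) (by linarith), min_eq_right (by linarith),
        tsub_zero]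
      congr 1
      ring

lemma measurableSet_hit (L : ℝ) :
    MeasurableSet {z : ℝ × ℝ | z.2 + z.1 ∈ Icc 0 L} := by
  have : Measurable fun z : ℝ × ℝ => z.2 + z.1 := by fun_prop
  exact this measurableSet_Icc

/-- The product is the probability that one of two independent displacements hits the window and the
other misses it; Tonelli integrates the starting point `x` first. -/
lemma lintegral_sectionProb_mul_compl (L : ℝ) :
    ∫⁻ x, μ {u | u + x ∈ Icc 0 L} * μ {u | u + x ∉ Icc 0 L} =
      ∫⁻ z : ℝ × ℝ, ENNReal.ofReal (min |z.1 - z.2| L) ∂(μ.prod μ) := by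
  let S : Set (ℝ × ℝ × ℝ) := {z | z.2.1 + z.1 ∈ Icc 0 L ∧ z.2.2 + z.1 ∉ Icc 0 L}
  have hS : MeasurableSet S :=
    (measurable_fst.prodMk measurable_snd.fst (measurableSet_hit L)).inter
      (measurable_fst.prodMk measurable_snd.snd (measurableSet_hit L).compl)
  have h1 := Measure.prod_apply (μ := (volume : Measure ℝ)) (ν := μ.prod μ) hS
  rw [Measure.prod_apply_symm hS] at h1
  calc _ = ∫⁻ x, (μ.prod μ) (Prod.mk x ⁻¹' S) := by
        refine lintegral_congr fun x => ?_
        rw [← Measure.prod_prod]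
        rfl
    _ = _ := by
        rw [← h1]
        exact lintegral_congr fun z => volume_Icc_diff_Icc L z.1 z.2

/-- As `e` runs over `[0, 1)`, `j - e` runs over `(j - 1, j]`, and these intervals tile the line. -/
lemma tsum_setLIntegral_Icc_intCast_sub {f : ℝ → ℝ≥0∞} :
    ∑' j : ℤ, ∫⁻ e in Icc (0 : ℝ) 1, f (j - e) = ∫⁻ y, f y := by
  have h : ∀ j : ℤ, ∫⁻ e in Icc (0 : ℝ) 1, f (j - e) = ∫⁻ y in Ioc ((j : ℝ) - 1) j, f y := by
    intro j
    rw [setLIntegral_congr (Ico_ae_eq_Icc (a := (0 : ℝ)) (b := 1)).symm,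
      ← lintegral_indicator measurableSet_Ico, ← lintegral_indicator measurableSet_Ioc,
      ← lintegral_sub_left_eq_self ((Ioc ((j : ℝ) - 1) j).indicator f) (j : ℝ)]
    refine lintegral_congr fun e => ?_
    by_cases he : e ∈ Ico (0 : ℝ) 1
    · rw [indicator_of_mem he, indicator_of_mem]
      exact ⟨by linarith [he.2], by linarith [he.1]⟩
    · rw [indicator_of_notMem he, indicator_of_notMem]
      exact fun h' => he ⟨by linarith [h'.2], by linarith [h'.1]⟩
  simp_rw [h]
  rw [← (Equiv.addRight (1 : ℤ)).tsum_eq]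
  have h2 : ∀ j : ℤ, Ioc (((Equiv.addRight (1 : ℤ)) j : ℝ) - 1) ((Equiv.addRight (1 : ℤ)) j : ℤ) =
      Ioc (j : ℝ) (j + 1) := by
    intro j
    simp
  simp_rw [h2]
  rw [← lintegral_iUnion (fun _ => measurableSet_Ioc) (pairwise_disjoint_Ioc_intCast ℝ),
    iUnion_Ioc_intCast, Measure.restrict_univ]

lemma lintegral_comp_mul_left_real {f : ℝ → ℝ≥0∞} (hf : Measurable f) {a : ℝ} (ha : 0 < a) :
    ∫⁻ y, f (a * y) = ENNReal.ofReal a⁻¹ * ∫⁻ y, f y := by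
  rw [← lintegral_map hf (measurable_const_mul a), Real.map_volume_mul_left ha.ne',
    lintegral_smul_measure, abs_of_pos (inv_pos.2 ha), smul_eq_mul]

/-- The law of the difference of two independent variables with law `μ`. -/
noncomputable def differenceLaw (μ : Measure ℝ) : Measure ℝ :=
  (μ.prod μ).map fun z => z.1 - z.2

instance : IsProbabilityMeasure (differenceLaw μ) :=
  Measure.isProbabilityMeasure_map (by fun_prop)

lemma charFun_differenceLaw (θ : ℝ) :
    charFun (differenceLaw μ) θ = charFun μ θ * charFun μ (-θ) := by
  simp only [charFun_apply_real]
  rw [differenceLaw, integral_map (by fun_prop) (by fun_prop), ← integral_prod_mul]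
  congr 1 with z
  rw [← Complex.exp_add]
  congr 1
  push_cast
  ring

variable {Ω : Type*} [MeasurableSpace Ω] {P : Measure Ω} [IsProbabilityMeasure P]
  {ε : Ω → ℝ} {Z : ℤ → Ω → ℝ}

/-- Each term of the variance series is the integral of one function `q` at `a (j - e)`. Unfolding
merges them into an integral over the line, and rescaling gives the factor `1/a`. -/
lemma IsPairwiseSystem.integral_condVar_hitSet
    (h : IsPairwiseSystem ε Z P (volume.restrict (Icc 0 1)) μ) {a L : ℝ} (ha : 0 < a)
    (hL : 0 ≤ L) :
    ∫ ω, condVar (MeasurableSpace.comap ε inferInstance) (eventCount ε Z (hitSet a L)) P ω ∂P =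
      (∫ y, min |y| L ∂(differenceLaw μ)) / a := by
  have : IsProbabilityMeasure (volume.restrict (Icc (0 : ℝ) 1)) := ⟨by simp⟩
  have hs := h.hasSum_integral_condVar (measurableSet_hitSet a L)
    (tsum_sectionProb_hitSet_le ha L) ENNReal.ofReal_ne_top
  let q : ℝ → ℝ≥0∞ := fun x => μ {u | u + x ∈ Icc 0 L} * μ {u | u + x ∉ Icc 0 L}
  have hq : Measurable q :=
    (measurable_measure_prodMk_left (measurableSet_hit L)).mul
      (measurable_measure_prodMk_left (measurableSet_hit L).compl)
  have hnn : ∀ j e, 0 ≤ (sectionProb μ (hitSet a L j) e).toReal *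
      (1 - (sectionProb μ (hitSet a L j) e).toReal) := fun j e =>
    mul_nonneg ENNReal.toReal_nonneg (sub_nonneg.2 (sectionProb_toReal_le_one e))
  have hterm : ∀ j : ℤ, ENNReal.ofReal (∫ e in Icc (0 : ℝ) 1,
      (sectionProb μ (hitSet a L j) e).toReal *
        (1 - (sectionProb μ (hitSet a L j) e).toReal)) =
      ∫⁻ e in Icc (0 : ℝ) 1, q (a * (j - e)) := by
    intro j
    have hm := (measurable_sectionProb (μ := μ) (measurableSet_hitSet a L j)).ennreal_toReal
    rw [ofReal_integral_eq_lintegral_ofReal _ (ae_of_all _ (hnn j))]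
    · refine lintegral_congr fun e => ?_
      rw [ENNReal.ofReal_mul ENNReal.toReal_nonneg, ENNReal.ofReal_sub _ ENNReal.toReal_nonneg,
        sectionProb, ENNReal.ofReal_toReal (measure_ne_top _ _), ENNReal.ofReal_one, ← prob_compl_eq_one_sub
          (measurable_prodMk_left (measurableSet_hitSet a L j))]
      rfl
    · refine (integrable_const (1 : ℝ)).mono' (hm.mul (hm.const_sub 1)).aestronglyMeasurable
        (ae_of_all _ fun e => ?_)
      rw [Real.norm_eq_abs, abs_of_nonneg (hnn j e)]
      have := sectionProb_toReal_le_one (μ := μ) (B := hitSet a L j) e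
      have := ENNReal.toReal_nonneg (a := sectionProb μ (hitSet a L j) e)
      nlinarith
  have hmin : ∀ y : ℝ, 0 ≤ min |y| L := fun y => le_min (abs_nonneg y) hL
  have hmm : Measurable fun y : ℝ => min |y| L := by fun_prop
  have hV0 := hs.nonneg fun j => integral_nonneg (hnn j)
  have key : ENNReal.ofReal (∫ ω, condVar (MeasurableSpace.comap ε inferInstance)
      (eventCount ε Z (hitSet a L)) P ω ∂P) =
      ENNReal.ofReal a⁻¹ * ∫⁻ y, ENNReal.ofReal (min |y| L) ∂(differenceLaw μ) := by
    rw [← hs.tsum_eq, ENNReal.ofReal_tsum_of_nonneg (fun j => integral_nonneg (hnn j)) hs.summable]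
    simp_rw [hterm]
    rw [tsum_setLIntegral_Icc_intCast_sub (f := fun y => q (a * y)),
      lintegral_comp_mul_left_real hq ha, lintegral_sectionProb_mul_compl L, differenceLaw,
      lintegral_map hmm.ennreal_ofReal (by fun_prop)]
  rw [← ENNReal.toReal_ofReal hV0, key, ENNReal.toReal_mul, ENNReal.toReal_ofReal (by positivity),
    integral_eq_lintegral_of_nonneg_ae (ae_of_all _ hmin) hmm.aestronglyMeasurable]
  ring

end Law

/-! ### The stable particle system. -/

section System

variable {Ω : Type*} [MeasurableSpace Ω] {P : Measure Ω} [IsProbabilityMeasure P]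
  {ε : Ω → ℝ} {X : ℤ → ℝ≥0 → Ω → ℝ} {α c a : ℝ} {t : ℝ≥0}

lemma IsStableSystem.map_eq (h : IsStableSystem α c ε X P) (i j : ℤ) :
    P.map (X i t) = P.map (X j t) := by
  have := Measure.isProbabilityMeasure_map (μ := P) ((h.stable i).measurable t).aemeasurable
  have := Measure.isProbabilityMeasure_map (μ := P) ((h.stable j).measurable t).aemeasurable
  refine Measure.ext_of_charFun (funext fun θ => ?_)
  rw [(h.stable i).charFun_eq, (h.stable j).charFun_eq]

lemma IsStableSystem.isPairwiseSystem (h : IsStableSystem α c ε X P) (t : ℝ≥0) :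
    IsPairwiseSystem ε (fun j => X j t) P (volume.restrict (Icc 0 1)) (P.map (X 0 t)) := by
  have hX : ∀ j, Measurable (X j t) := fun j => (h.stable j).measurable t
  have hU : P.map ε = volume.restrict (Icc 0 1) := by
    have := h.uniform_shift
    rw [pdf.IsUniform, ProbabilityTheory.cond] at this
    simpa using this
  refine ⟨h.measurable_shift, hX, fun j => ?_, fun i j hij => ?_⟩
  · have hi : IndepFun ε (X j t) P :=
      h.indep_shift.comp (φ := id) (ψ := fun x : ℤ → ℝ≥0 → ℝ => x j t) measurable_id (by fun_prop)
    rw [(indepFun_iff_map_prod_eq_prod_map_map h.measurable_shift.aemeasurable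
      (hX j).aemeasurable).1 hi, hU, h.map_eq j 0]
  · have hi : IndepFun ε (fun ω => (X i t ω, X j t ω)) P :=
      h.indep_shift.comp (φ := id) (ψ := fun x : ℤ → ℝ≥0 → ℝ => (x i t, x j t)) measurable_id
        (by fun_prop)
    have hij' : IndepFun (X i t) (X j t) P :=
      (h.indep.indepFun hij).comp (φ := fun x : ℝ≥0 → ℝ => x t) (ψ := fun x : ℝ≥0 → ℝ => x t)
        (by fun_prop) (by fun_prop)
    rw [(indepFun_iff_map_prod_eq_prod_map_map h.measurable_shift.aemeasurable
      ((hX i).prodMk (hX j)).aemeasurable).1 hi, hU,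
      (indepFun_iff_map_prod_eq_prod_map_map (hX i).aemeasurable (hX j).aemeasurable).1 hij',
      h.map_eq i 0, h.map_eq j 0]

lemma IsStableSystem.numberVariance_eq (h : IsStableSystem α c ε X P) (ha : 0 < a) {L : ℝ}
    (hL : 0 ≤ L) : numberVariance a ε X t P L =
      (∫ y, min |y| L ∂(differenceLaw (P.map (X 0 t)))) / a := by
  have := Measure.isProbabilityMeasure_map (μ := P) ((h.stable 0).measurable t).aemeasurable
  exact (h.isPairwiseSystem t).integral_condVar_hitSet ha hL

lemma IsStableSystem.charFun_differenceLaw (h : IsStableSystem α c ε X P) (θ : ℝ) :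
    charFun (differenceLaw (P.map (X 0 t))) θ =
      ((Real.exp (-(2 * t * c * |θ| ^ α)) : ℝ) : ℂ) := by
  have := Measure.isProbabilityMeasure_map (μ := P) ((h.stable 0).measurable t).aemeasurable
  rw [StableParticles.charFun_differenceLaw, (h.stable 0).charFun_eq, (h.stable 0).charFun_eq,
    abs_neg, ← Complex.ofReal_mul, ← Real.exp_add]
  congr 2
  ring

lemma IsSymmetricStable.integrable_abs {Y : ℝ≥0 → Ω → ℝ} (h : IsSymmetricStable α c Y P)
    (hα : 1 < α) (hc : 0 < c) {r : ℝ≥0} (hr : 0 < r) : Integrable (Y r) P ∧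
      ∫ ω, |Y r ω| ∂P = 2 / Real.pi * ((r * c) ^ (1 / α) * Real.Gamma (1 - 1 / α)) := by
  have hm := (h.measurable r).aemeasurable (μ := P)
  have := Measure.isProbabilityMeasure_map hm
  obtain ⟨hi, he⟩ := integrable_abs_of_stable (s := r * c) hα (by positivity) (h.charFun_eq r)
  rw [integral_map hm (by fun_prop)] at he
  refine ⟨?_, he⟩
  have := (integrable_map_measure (by fun_prop) hm).1 hi
  exact (integrable_norm_iff (h.measurable r).aestronglyMeasurable).1 this

lemma kappaSat_eq (α c a t : ℝ) : kappaSat α c a t =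
    2 / Real.pi * ((2 * t * c) ^ (1 / α) * Real.Gamma (1 - 1 / α)) / a := by
  rw [kappaSat]
  field_simp

lemma kappaSat_pos {t : ℝ} (hα : 1 < α) (hc : 0 < c) (ha : 0 < a) (ht : 0 < t) :
    0 < kappaSat α c a t := by
  have : 0 < 1 - 1 / α := sub_pos.2 ((div_lt_one (by linarith)).2 hα)
  have := Real.Gamma_pos_of_pos this
  rw [kappaSat]
  positivity

/-- Self-similarity: replacing the time `2t` by `2t / a^α` divides the scale `(2tc)^(1/α)` by `a`.
-/
lemma IsStableSystem.integral_abs_eq_kappaSat (h : IsStableSystem α c ε X P) (hα : 1 < α)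
    (hc : 0 < c) (ha : 0 < a) (ht : 0 < t) (j : ℤ) :
    Integrable (X j (Real.toNNReal (2 * t / a ^ α))) P ∧
      ∫ ω, |X j (Real.toNNReal (2 * t / a ^ α)) ω| ∂P = kappaSat α c a t := by
  have ht' : (0 : ℝ) < t := ht
  have hα0 : 0 < α := by linarith
  have hr : 0 < 2 * t / a ^ α := by positivity
  obtain ⟨hi, he⟩ := (h.stable j).integrable_abs hα hc (Real.toNNReal_pos.2 hr)
  refine ⟨hi, he.trans ?_⟩
  rw [Real.coe_toNNReal _ hr.le, kappaSat_eq, div_mul_eq_mul_div _ _ c,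
    Real.div_rpow (by positivity) (by positivity), ← Real.rpow_mul ha.le,
    mul_one_div_cancel hα0.ne', Real.rpow_one]
  ring

end System

/-- Asymptotic equivalence from convergence of the quotient by the leading term. -/
lemma sim_of_tendsto_div {g h : ℝ → ℝ} {k : ℝ} (hk : k ≠ 0)
    (hg : Tendsto (fun L => g L / h L) atTop (𝓝 k)) : Sim g fun L => k * h L := by
  have := hg.div_const k
  rw [div_self hk] at this
  refine this.congr fun L => ?_
  rw [div_div, mul_comm]

/-- Used in the saturated regimes: both sides tend to `κ_sat ≠ 0`, whatever the decaying term. -/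
lemma sim_of_tendsto {g h : ℝ → ℝ} {κ : ℝ} (hκ : κ ≠ 0) (hg : Tendsto g atTop (𝓝 κ))
    (hh : Tendsto h atTop (𝓝 κ)) : Sim g h := by
  have := hg.div hh hκ
  rwa [div_self hκ] at this

end Count

end StableParticles

/-! ### The main theorem. -/

open StableParticles in
theorem mainTheorem2 (α c a : ℝ) (t : ℝ≥0) (hα0 : 0 < α) (hα2 : α ≤ 2) (hc : 0 < c)
    (ha : 0 < a) (ht : 0 < t) :
    ∃ k : ℝ, k ≠ 0 ∧
      ∀ (Ω : Type*) [MeasurableSpace Ω] (P : Measure Ω) [IsProbabilityMeasure P]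
        (ε : Ω → ℝ) (X : ℤ → ℝ≥0 → Ω → ℝ), IsStableSystem α c ε X P →
        (∀ L : ℝ, (∀ᵐ ω ∂P, {j : ℤ | position a ε X t j ω ∈ Set.Icc 0 L}.Finite) ∧
          MemLp (count a ε X t L) 2 P) ∧
        (α < 1 →
          Sim (numberVariance a ε X t P) (fun L => k * L ^ (1 - α))) ∧
        (α = 1 →
          Sim (numberVariance a ε X t P) (fun L => k * Real.log L)) ∧
        (1 < α → α < 2 →
          Sim (numberVariance a ε X t P) (fun L => k * L ^ (1 - α) + kappaSat α c a t) ∧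
          Sim (fun L => numberVariance a ε X t P L - kappaSat α c a t)
            (fun L => k * L ^ (1 - α))) ∧
        (α = 2 →
          Sim (numberVariance a ε X t P)
            (fun L => k * Real.exp (-L ^ 2 / (8 * c * t)) + kappaSat α c a t) ∧
          (fun L => numberVariance a ε X t P L - kappaSat α c a t)
            =O[atTop] fun L => Real.exp (-L ^ 2 / (8 * c * t))) ∧
        (1 < α → ∀ j : ℤ,
          Integrable (X j (Real.toNNReal (2 * t / a ^ α))) P ∧
          ∫ ω, |X j (Real.toNNReal (2 * t / a ^ α)) ω| ∂P = kappaSat α c a t) := by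
  have ht' : (0 : ℝ) < t := ht
  have hs : 0 < 2 * (t : ℝ) * c := by positivity
  have hk := tailConst_pos hα0 hs
  -- For `1 < α < 2` the constant is negative because `min |y| L ≤ |y|`: saturation is approached
  -- from below.
  refine ⟨if α ≤ 1 then tailConst α (2 * t * c) / a else -tailConst α (2 * t * c) / a, ?_, ?_⟩
  · split_ifs
    · exact (div_pos hk ha).ne'
    · exact (div_neg_of_neg_of_pos (neg_neg_of_pos hk) ha).ne
  intro Ω _ P _ ε X h
  have := Measure.isProbabilityMeasure_map (μ := P) ((h.stable 0).measurable t).aemeasurable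
  have : IsProbabilityMeasure (volume.restrict (Set.Icc (0 : ℝ) 1)) := ⟨by simp⟩
  have hV : ∀ L, 0 ≤ L → numberVariance a ε X t P L = _ := fun L hL => h.numberVariance_eq ha hL
  have hρ := h.charFun_differenceLaw (t := t)
  refine ⟨fun L => ⟨?_, ?_⟩, fun hα => ?_, fun hα => ?_, fun hα1 hα2 => ?_, fun hα => ?_,
    fun hα => h.integral_abs_eq_kappaSat hα hc ha ht⟩
  · exact (h.isPairwiseSystem t).ae_finite (measurableSet_hitSet a L)
      (tsum_sectionProb_hitSet_le ha L) ENNReal.ofReal_ne_top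
  · exact (h.isPairwiseSystem t).memLp_eventCount (measurableSet_hitSet a L)
      (tsum_sectionProb_hitSet_le ha L) ENNReal.ofReal_ne_top
  · rw [if_pos hα.le]
    refine sim_of_tendsto_div (div_pos hk ha).ne' ?_
    refine ((tendsto_integral_min_abs_of_lt_one hα0 hα hs hρ).div_const a).congr' ?_
    filter_upwards [eventually_ge_atTop 0] with L hL
    rw [hV L hL, div_right_comm]
  · rw [if_pos hα.le]
    refine sim_of_tendsto_div (div_pos hk ha).ne' ?_
    refine ((tendsto_integral_min_abs_of_eq_one hα hs hρ).div_const a).congr' ?_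
    filter_upwards [eventually_ge_atTop 0] with L hL
    rw [hV L hL, div_right_comm]
  · rw [if_neg (not_le.2 hα1)]
    have hkap : kappaSat α c a t = _ / a :=
      (kappaSat_eq α c a t).trans (by rw [← (integrable_abs_of_stable hα1 hs hρ).2])
    have hκ := kappaSat_pos hα1 hc ha ht'
    have hlim : Tendsto (fun L => (numberVariance a ε X t P L - kappaSat α c a t) / L ^ (1 - α))
        atTop (𝓝 (-tailConst α (2 * t * c) / a)) := by
      refine ((tendsto_integral_min_abs_of_one_lt hα1 hα2 hs hρ).div_const a).congr' ?_
      filter_upwards [eventually_ge_atTop 0] with L hL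
      rw [hV L hL, hkap, ← sub_div, div_right_comm]
    have hpow : Tendsto (fun L : ℝ => L ^ (1 - α)) atTop (𝓝 0) := by
      rw [show 1 - α = -(α - 1) by ring]
      exact tendsto_rpow_neg_atTop (by linarith)
    refine ⟨sim_of_tendsto hκ.ne' ?_ ?_,
      sim_of_tendsto_div (div_neg_of_neg_of_pos (neg_neg_of_pos hk) ha).ne hlim⟩
    · have := (hlim.mul hpow).add_const (kappaSat α c a t)
      rw [mul_zero, zero_add] at this
      refine this.congr' ?_
      filter_upwards [eventually_gt_atTop 0] with L hL
      rw [div_mul_cancel₀ _ (Real.rpow_pos_of_pos hL _).ne', sub_add_cancel]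
    · simpa using (hpow.const_mul (-tailConst α (2 * t * c) / a)).add_const (kappaSat α c a t)
  · have hα1 : 1 < α := by linarith
    rw [if_neg (not_le.2 hα1)]
    have hkap : kappaSat α c a t = _ / a :=
      (kappaSat_eq α c a t).trans (by rw [← (integrable_abs_of_stable hα1 hs hρ).2])
    have hκ := kappaSat_pos hα1 hc ha ht'
    have hO : (fun L => numberVariance a ε X t P L - kappaSat α c a t)
        =O[atTop] fun L => Real.exp (-L ^ 2 / (8 * c * t)) := by
      -- The Gaussian bound has constant `2 𝔼|Y|`, which is `2 κ_sat` after division by `a`, and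
      -- exponent `L² / (4s)` with `s = 2tc`.
      refine IsBigO.of_bound (2 * kappaSat α c a t) ?_
      filter_upwards [eventually_ge_atTop 0] with L hL
      have hb := integral_abs_sub_integral_min_abs_le_of_eq_two hα hs hρ hL
      rw [hV L hL, hkap, ← sub_div, Real.norm_eq_abs, Real.norm_eq_abs, Real.abs_exp, abs_div,
        abs_of_pos ha, show 8 * c * (t : ℝ) = 4 * (2 * t * c) by ring, mul_div_assoc',
        div_mul_eq_mul_div]
      gcongr
      rwa [mul_comm]
    have hexp : Tendsto (fun L : ℝ => Real.exp (-L ^ 2 / (8 * c * t))) atTop (𝓝 0) := by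
      refine Real.tendsto_exp_atBot.comp ?_
      have : Tendsto (fun L : ℝ => L ^ 2 / (8 * c * t)) atTop atTop :=
        (tendsto_pow_atTop two_ne_zero).atTop_div_const (by positivity)
      exact (tendsto_neg_atTop_atBot.comp this).congr fun L => (neg_div _ _).symm
    refine ⟨sim_of_tendsto hκ.ne' ?_ ?_, hO⟩
    · simpa using (hO.trans_tendsto hexp).add_const (kappaSat α c a t)
    · have := (hexp.const_mul (-tailConst α (2 * t * c) / a)).add_const (kappaSat α c a t)
      rwa [mul_zero, zero_add] at this
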